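/- Fix an integer $k\ge 0$. There are a program $P$ for a random access machine and a polynomial $p$, both depending only on $k$, such that the following holds for every $n\ge 0$, every simple graph $H$ on $[n]=\{1,\dots,n\}$ of treewidth at most $k$, and all functions $f_1,\dots,f_n:\{0,1,\dots,n-1\}\to\mathbb{Z}$. Given $n$, the adjacency matrix of $H$ and the table of all values $f_i(d)$ as input, $P$ halts after at most $p(n)$ steps and outputs $$\min\Big\{\sum_{i=1}^n f_i(d_i(G))\ :\ G \text{ a graph on } [n] \text{ with } E(G)\subseteq E(H)\Big\},$$ where $d_i(G)$ is the degree of vertex $i$ in $G$. Here the machine has integer memory cells with indirect addressing; its elementary operations, each of which takes one step, are reading and writing a cell, addition, subtraction, using a constant, and branching on whether a number is positive. (As there is no multiplication, this implies that the problem is solvable on a Turing machine in time polynomial in the binary length of the input.) The treewidth of $H$ is the minimum, over all tree decompositions of $H$, of the maximum cardinality of a bag minus one (taken to be $0$ for the graph without vertices). A tree decomposition consists of a finite tree and a bag $I_v\subseteq[n]$ for each node $v$ such that every vertex of $H$ lies in some bag, both ends of every edge of $H$ lie in a common bag, and $I_u\cap I_w\subseteq I_v$ whenever $v$ lies on the path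 in the tree between $u$ and $w$. -/

import Mathlib

namespace DegSeq

/-! ## Treewidth -/

/-- A tree decomposition of a graph `H`: a finite tree with a bag of vertices of `H` at each node,
such that the bags cover all vertices and all edges of `H`, and a vertex lying in the bags of two
nodes lies in the bag of every node on the path between them. -/
structure TreeDecomposition {V : Type} (H : SimpleGraph V) where
  numNodes : ℕ
  tree : SimpleGraph (Fin numNodes)
  isTree : tree.IsTree
  bag : Fin numNodes → Finset V
  vertex_mem : ∀ i : V, ∃ v, i ∈ bag v
  edge_mem : ∀ i j : V, H.Adj i j → ∃ v, i ∈ bag v ∧ j ∈ bag v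
  path_mem : ∀ (u w : Fin numNodes) (q : tree.Walk u w), q.IsPath →
    ∀ v ∈ q.support, ∀ i : V, i ∈ bag u → i ∈ bag w → i ∈ bag v

/-- The width: the maximum cardinality of a bag minus one. (The subtraction truncates only when all
bags are empty, that is, for the graph without vertices, which gets width `0`.) -/
def TreeDecomposition.width {V : Type} {H : SimpleGraph V} (D : TreeDecomposition H) : ℕ :=
  (Finset.univ.sup fun v => (D.bag v).card) - 1

/-- The treewidth: the minimum width of a tree decomposition. -/
noncomputable def treewidth {V : Type} (H : SimpleGraph V) : ℕ∞ :=
  ⨅ D : TreeDecomposition H, (D.width : ℕ∞)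

/-! ## The objective function -/

open Classical in
/-- `∑ i, f_i (d_i(G))`, where `d_i(G)` is the degree of `i` in `G`, an element of
`{0, …, n - 1}`. -/
noncomputable def degreeCost {n : ℕ} (f : Fin n → Fin n → ℤ) (G : SimpleGraph (Fin n)) : ℤ :=
  ∑ i : Fin n, f i ⟨G.degree i, by simpa using G.degree_lt_card_verts i⟩

/-! ## Random access machines

The memory consists of arrays of integer cells. Array names are fixed in the program, so that a
program uses finitely many arrays; indices into an array are computed at run time (indirect
addressing). The arithmetic operations are addition and subtraction, the only test is for
positivity, and each operation takes one step. There is no multiplication: one step at most doubles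
the largest absolute value in play, so that the numbers in a computation of `t` steps have at most
`O(t)` bits more than those in the input and in the program, and the number of steps agrees, up to
a polynomial in itself and the bit length of the input, with the time on a Turing machine. -/

/-- The contents of the memory: the array `a` has the value `s a x` at index `x`. -/
abbrev Store : Type := ℕ → ℤ → ℤ

/-- Integer expressions. -/
inductive RExpr : Type
  | const (c : ℤ) : RExpr
  | read (a : ℕ) (index : RExpr) : RExpr
  | add (e₁ e₂ : RExpr) : RExpr
  | sub (e₁ e₂ : RExpr) : RExpr

/-- The value of an expression. -/
def RExpr.eval (s : Store) : RExpr → ℤ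
  | .const c => c
  | .read a e => s a (e.eval s)
  | .add e₁ e₂ => e₁.eval s + e₂.eval s
  | .sub e₁ e₂ => e₁.eval s - e₂.eval s

/-- The number of steps needed to evaluate an expression, one for each operation in it. -/
def RExpr.cost : RExpr → ℕ
  | .const _ => 1
  | .read _ e => e.cost + 1
  | .add e₁ e₂ => e₁.cost + e₂.cost + 1
  | .sub e₁ e₂ => e₁.cost + e₂.cost + 1

/-- Programs: `write a e₁ e₂` stores the value of `e₂` in the array `a` at the index given by `e₁`;
`ite e P Q` runs `P` if the value of `e` is positive and `Q` otherwise; `loop e P` runs `P` again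
and again as long as the value of `e` is positive. -/
inductive Program : Type
  | skip : Program
  | write (a : ℕ) (index value : RExpr) : Program
  | seq (P Q : Program) : Program
  | ite (cond : RExpr) (P Q : Program) : Program
  | loop (cond : RExpr) (P : Program) : Program

/-- The memory after storing the value `y` in the array `a` at index `x`. -/
def Store.set (s : Store) (a : ℕ) (x y : ℤ) : Store :=
  fun b z => if b = a ∧ z = x then y else s b z

/-- `Exec P s t s'`: started with memory `s`, the program `P` halts after exactly `t` steps, with
memory `s'`. -/
inductive Exec : Program → Store → ℕ → Store → Prop
  | skip (s : Store) : Exec .skip s 1 s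
  | write (a : ℕ) (e₁ e₂ : RExpr) (s : Store) :
      Exec (.write a e₁ e₂) s (e₁.cost + e₂.cost + 1) (s.set a (e₁.eval s) (e₂.eval s))
  | seq {P Q : Program} {s s' s'' : Store} {t t' : ℕ} :
      Exec P s t s' → Exec Q s' t' s'' → Exec (.seq P Q) s (t + t') s''
  | ite_true {e : RExpr} {P Q : Program} {s s' : Store} {t : ℕ} :
      0 < e.eval s → Exec P s t s' → Exec (.ite e P Q) s (e.cost + 1 + t) s'
  | ite_false {e : RExpr} {P Q : Program} {s s' : Store} {t : ℕ} :
      ¬ 0 < e.eval s → Exec Q s t s' → Exec (.ite e P Q) s (e.cost + 1 + t) s'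
  | loop_true {e : RExpr} {P : Program} {s s' s'' : Store} {t t' : ℕ} :
      0 < e.eval s → Exec P s t s' → Exec (.loop e P) s' t' s'' →
        Exec (.loop e P) s (e.cost + 1 + t + t') s''
  | loop_false {e : RExpr} {P : Program} {s : Store} :
      ¬ 0 < e.eval s → Exec (.loop e P) s (e.cost + 1) s

/-! ## The input -/

/-- An `n × n` matrix stored row by row in an array: the entry `A i j` at index `i * n + j`, for
`i, j` in `{0, …, n - 1}`, and `0` at all other indices. -/
def matrixArray {n : ℕ} (A : Fin n → Fin n → ℤ) (x : ℤ) : ℤ :=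
  ∑ i : Fin n, ∑ j : Fin n, if x = (i : ℤ) * (n : ℤ) + (j : ℤ) then A i j else 0

open Classical in
/-- The memory that holds an instance of the problem: the number `n` in array `0` at index `0`, the
adjacency matrix of `H` in array `1`, the table of the values `f_i(d)` in array `2`, and `0` in all
other cells. -/
noncomputable def inputStore {n : ℕ} (H : SimpleGraph (Fin n)) (f : Fin n → Fin n → ℤ) : Store
  | 0 => fun x => if x = 0 then (n : ℤ) else 0
  | 1 => matrixArray fun i j => if H.Adj i j then 1 else 0
  | 2 => matrixArray f
  | _ => fun _ => 0

end DegSeq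

/-!
The algorithm is a dynamic program over pieces of `H` that are cut off by small sets of vertices. It
does not look for a tree decomposition; it takes the minimum over all ways of building up the graph
from such pieces, and the tree decomposition enters only into the proof that this minimum is the
right one.

A bag `B` is a tuple of `k + 1` vertices or placeholders. A state consists of a bag `B`, a number
`j` and numbers `d p` for the entries of the bag. It stands for the region formed by those components
of `H - B` that are adjacent to `B 0` and contain a vertex below `j` (`region`). The value of a state
is the least contribution of the vertices of the region to the objective, over all subgraphs `G` in
which the vertex `B p` has `d p` neighbours in the region. Passing from `j` to `j + 1` adds at most
one component, the one with least vertex `j`. To add it, a vertex `r` of this component and an entry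
of `B` not adjacent to it are chosen; with `r` in place of this entry and moved to the front, the bag
becomes a bag whose region is the component without `r` (`child`, `mem_region_child`). So the new
region splits into the old one, the vertex `r` and the region of the child (`split_region`), and the
contributions and the numbers of neighbours add up, once the edges between `r` and the bag are fixed
(`Split.degIn_eq`, `Split.costIn_eq`). The recursion starts from empty regions, and the bag that
consists of placeholders only has the whole graph as its region (`region_root`).

Every value derived by these rules is attained, since subgraphs on the three parts can be glued
(`Attained.succ_of_new`). Conversely, a tree decomposition of width at most `k` gives an ordering of
the vertices in which each `r` has at most `k` later neighbours of the set reachable from it through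
earlier vertices: order them by the distance from the root of their bags (`exists_isElimination`). If
`r` is always the last vertex of its component, then there is an entry of the bag to drop, because
the neighbours of the component are later than `r` and hence at most `k` in number (`exists_child`).
So every subgraph has its value derived (`derivable_of_isElimination`), within `(n + 1) ^ 2` rounds
through all rules; as `k` is fixed, there are only polynomially many rules.

On the side of the machine, `Comp` says that a function of an instance and of some variables is
computable in polynomial time. This is closed under arithmetic, case distinctions and sums
(`Comp.sum`), and under filling a table by polynomially many rules of the form "the entry `h` is at
most the sum of the entries `p`, `q` and a weight" (`Comp.table`). Reachability and the dynamic
program itself are both instances of the last operation.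
-/

namespace DegSeq

/-! ### Running programs -/

/-- Started with memory `s`, the program `P` halts within `T` steps in a memory satisfying `Q`. -/
def Runs (P : Program) (s : Store) (T : ℕ) (Q : Store → Prop) : Prop :=
  ∃ t s', Exec P s t s' ∧ t ≤ T ∧ Q s'

theorem Runs.mono {P : Program} {s : Store} {T T' : ℕ} {Q Q' : Store → Prop} (h : Runs P s T Q)
    (hT : T ≤ T') (hQ : ∀ s', Q s' → Q' s') : Runs P s T' Q' := by
  obtain ⟨t, s', he, ht, hq⟩ := h
  exact ⟨t, s', he, ht.trans hT, hQ _ hq⟩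

theorem Runs.seq {P P' : Program} {s : Store} {T T' : ℕ} {Q Q' : Store → Prop} (h : Runs P s T Q)
    (h' : ∀ s', Q s' → Runs P' s' T' Q') : Runs (.seq P P') s (T + T') Q' := by
  obtain ⟨t, s', he, ht, hq⟩ := h
  obtain ⟨t', s'', he', ht', hq'⟩ := h' s' hq
  exact ⟨t + t', s'', .seq he he', by omega, hq'⟩

theorem Runs.write {a : ℕ} {e₁ e₂ : RExpr} {s : Store} {Q : Store → Prop}
    (h : Q (s.set a (e₁.eval s) (e₂.eval s))) :
    Runs (.write a e₁ e₂) s (e₁.cost + e₂.cost + 1) Q :=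
  ⟨_, _, .write a e₁ e₂ s, le_rfl, h⟩

theorem Runs.skip {s : Store} {Q : Store → Prop} (h : Q s) : Runs .skip s 1 Q :=
  ⟨_, _, .skip s, le_rfl, h⟩

theorem Runs.ite {e : RExpr} {P P' : Program} {s : Store} {T T' : ℕ} {Q : Store → Prop}
    (h : 0 < e.eval s → Runs P s T Q) (h' : ¬ 0 < e.eval s → Runs P' s T' Q) :
    Runs (.ite e P P') s (e.cost + 1 + (T + T')) Q := by
  by_cases he : 0 < e.eval s
  · obtain ⟨t, s', hx, ht, hq⟩ := h he
    exact ⟨_, s', .ite_true he hx, by omega, hq⟩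
  · obtain ⟨t, s', hx, ht, hq⟩ := h' he
    exact ⟨_, s', .ite_false he hx, by omega, hq⟩

/-- A loop whose condition counts up to `N`, with an invariant `I i` before the `i`-th pass. -/
theorem Runs.loop {e : RExpr} {P : Program} {N T : ℕ} (I : ℕ → Store → Prop)
    (hcond : ∀ i ≤ N, ∀ s, I i s → (0 < e.eval s ↔ i < N))
    (hbody : ∀ i < N, ∀ s, I i s → Runs P s T (I (i + 1))) {s : Store} (h0 : I 0 s) :
    Runs (.loop e P) s (N * (e.cost + 1 + T) + (e.cost + 1)) (I N) := by
  suffices H : ∀ j i s, i + j = N → I i s →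
      Runs (.loop e P) s (j * (e.cost + 1 + T) + (e.cost + 1)) (I N) from H N 0 s (by simp) h0
  intro j
  induction j with
  | zero =>
    intro i s hi hs
    obtain rfl : i = N := by omega
    exact ⟨_, s, .loop_false (by rw [hcond i le_rfl s hs]; simp), by simp, hs⟩
  | succ j ih =>
    intro i s hi hs
    obtain ⟨t, s', hx, ht, hq⟩ := hbody i (by omega) s hs
    obtain ⟨t', s'', hx', ht', hq'⟩ := ih (i + 1) s' (by omega) hq
    refine ⟨_, s'', .loop_true ((hcond i (by omega) s hs).2 (by omega)) hx hx', ?_, hq'⟩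
    rw [Nat.succ_mul]
    omega

theorem Store.set_same (s : Store) (a : ℕ) (x y : ℤ) : s.set a x y a x = y := by simp [Store.set]

theorem Store.set_array (s : Store) {a b : ℕ} (x y : ℤ) (h : b ≠ a) : s.set a x y b = s b := by
  funext z
  simp [Store.set, h]

/-- Reading the cell with index `0` of an array. -/
abbrev RExpr.cell (a : ℕ) : RExpr := .read a (.const 0)

/-- Writing the cell with index `0` of an array. -/
abbrev Program.setCell (a : ℕ) (e : RExpr) : Program := .write a (.const 0) e

theorem Runs.setCell {a : ℕ} {e : RExpr} {s : Store} {Q : Store → Prop}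
    (h : ∀ s' : Store, s' a 0 = e.eval s → (∀ b, b ≠ a → s' b = s b) → Q s') :
    Runs (.setCell a e) s (e.cost + 2) Q :=
  (Runs.write (h _ (Store.set_same ..) fun _ hb => Store.set_array _ _ _ hb)).mono
    (by simp only [RExpr.cost]; omega) fun _ => id

/-! ### Functions computable in polynomial time -/

/-- An instance of the optimization problem. -/
structure Inst where
  n : ℕ
  graph : SimpleGraph (Fin n)
  cost : Fin n → Fin n → ℤ

/-- A context in which functions are computed: the type `X` of the arguments, each of which belongs
to an instance and determines the values of integer variables indexed by `ι`. Only valid arguments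
matter. -/
structure Ctx where
  X : Type
  inst : X → Inst
  Valid : X → Prop
  ι : Type
  var : ι → X → ℤ

/-- The order of the instance that an argument belongs to. -/
abbrev Ctx.n (Γ : Ctx) (x : Γ.X) : ℕ := (Γ.inst x).n

/-- The context extended by one more variable, a natural number below `N`. -/
def Ctx.ext (Γ : Ctx) (N : Γ.X → ℕ) : Ctx where
  X := Γ.X × ℕ
  inst p := Γ.inst p.1
  Valid p := Γ.Valid p.1 ∧ p.2 < N p.1
  ι := Option Γ.ι
  var i p := i.elim (p.2 : ℤ) fun i => Γ.var i p.1

/-- The memory `s` holds the argument `x`: the instance is in the arrays `0`, `1`, `2` and the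
variable `i` is in the array `loc i` at index `0`. -/
def Ctx.Rep (Γ : Ctx) (loc : Γ.ι → ℕ) (s : Store) (x : Γ.X) : Prop :=
  (∀ a < 3, s a = inputStore (Γ.inst x).graph (Γ.inst x).cost a) ∧ ∀ i, s (loc i) 0 = Γ.var i x

theorem Ctx.Rep.congr {Γ : Ctx} {loc : Γ.ι → ℕ} {s s' : Store} {x : Γ.X} {M : ℕ} (h : Γ.Rep loc s x)
    (hM : 3 ≤ M) (hloc : ∀ i, loc i < M) (hs : ∀ a < M, s' a = s a) : Γ.Rep loc s' x :=
  ⟨fun a ha => by rw [hs a (by omega), h.1 a ha], fun i => by rw [hs _ (hloc i), h.2 i]⟩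

/-- The function `E` is computable in polynomial time: wherever the variables are, and for each `M`
beyond the arrays in use, there is a program that stores the value of `E` in the array `M` and
leaves the arrays below `M` as they are. -/
def Comp (Γ : Ctx) (E : Γ.X → ℤ) : Prop :=
  ∀ (loc : Γ.ι → ℕ) (M : ℕ), 3 ≤ M → (∀ i, loc i < M) →
    ∃ (P : Program) (q : Polynomial ℕ), ∀ x, Γ.Valid x → ∀ s, Γ.Rep loc s x →
      Runs P s (q.eval (Γ.n x)) fun s' => (∀ a < M, s' a = s a) ∧ s' M 0 = E x

variable {Γ : Ctx}

theorem Comp.congr {E E' : Γ.X → ℤ} (h : Comp Γ E) (hE : ∀ x, Γ.Valid x → E' x = E x) :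
    Comp Γ E' := by
  intro loc M hM hloc
  obtain ⟨P, q, hP⟩ := h loc M hM hloc
  refine ⟨P, q, fun x hx s hs => ?_⟩
  rw [hE x hx]
  exact hP x hx s hs

theorem Comp.const (c : ℤ) : Comp Γ fun _ => c := by
  intro loc M hM hloc
  refine ⟨.setCell M (.const c), 3, fun x hx s hs => (Runs.setCell fun s' h1 h2 => ?_).mono
    (by simp [RExpr.cost]) fun _ => id⟩
  exact ⟨fun a ha => h2 a ha.ne, h1⟩

theorem Comp.var (i : Γ.ι) : Comp Γ (Γ.var i) := by
  intro loc M hM hloc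
  refine ⟨.setCell M (.cell (loc i)), 4, fun x hx s hs => (Runs.setCell fun s' h1 h2 => ?_).mono
    (by simp [RExpr.cost]) fun _ => id⟩
  exact ⟨fun a ha => h2 a ha.ne, h1.trans (hs.2 i)⟩

/-- Enlarging the context. -/
theorem Comp.weaken {E : Γ.X → ℤ} (h : Comp Γ E) (N : Γ.X → ℕ) :
    Comp (Γ.ext N) fun p => E p.1 := by
  intro loc M hM hloc
  obtain ⟨P, q, hP⟩ := h (fun i => loc (some i)) M hM fun i => hloc _
  exact ⟨P, q, fun x hx s hs => hP x.1 hx.1 s ⟨hs.1, fun i => hs.2 (some i)⟩⟩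

theorem Comp.last (N : Γ.X → ℕ) : Comp (Γ.ext N) fun p => (p.2 : ℤ) :=
  Comp.var (Γ := Γ.ext N) none

theorem Comp.input {E : Γ.X → ℤ} (h : Comp Γ E) {a : ℕ} (ha : a < 3) :
    Comp Γ fun x => inputStore (Γ.inst x).graph (Γ.inst x).cost a (E x) := by
  intro loc M hM hloc
  obtain ⟨P, q, hP⟩ := h loc M hM hloc
  refine ⟨.seq P (.setCell M (.read a (.cell M))), q + 5, fun x hx s hs => ((hP x hx s hs).seq
    (T' := 5) ?_).mono (by simp) fun _ => id⟩
  rintro s' ⟨h1, h2⟩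
  refine (Runs.setCell fun s'' h3 h4 => ?_).mono (by simp [RExpr.cost]) fun _ => id
  refine ⟨fun b hb => by rw [h4 b hb.ne, h1 b hb], ?_⟩
  rw [h3]
  simp only [RExpr.eval]
  rw [h2, h1 a (by omega), hs.1 a ha]

/-- A binary operation of the machine. -/
theorem Comp.binary {E E' : Γ.X → ℤ} (h : Comp Γ E) (h' : Comp Γ E')
    (o : RExpr → RExpr → RExpr) (o' : ℤ → ℤ → ℤ)
    (ho : ∀ s e e', (o e e').eval s = o' (e.eval s) (e'.eval s)) :
    Comp Γ fun x => o' (E x) (E' x) := by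
  intro loc M hM hloc
  obtain ⟨P, q, hP⟩ := h loc M hM hloc
  obtain ⟨P', q', hP'⟩ := h' loc (M + 1) (by omega) fun i => (hloc i).trans (by omega)
  refine ⟨.seq P (.seq P' (.setCell M (o (.cell M) (.cell (M + 1))))),
    q + (q' + ((o (.cell M) (.cell (M + 1))).cost + 2 : ℕ)), fun x hx s hs => ?_⟩
  refine ((hP x hx s hs).seq (T' := q'.eval (Γ.n x) +
    ((o (.cell M) (.cell (M + 1))).cost + 2)) ?_).mono
    (by simp) fun _ => id
  rintro s1 ⟨h1, h2⟩
  refine (hP' x hx s1 (hs.congr hM hloc h1)).seq ?_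
  rintro s2 ⟨h3, h4⟩
  refine Runs.setCell fun s3 h5 h6 => ?_
  refine ⟨fun b hb => by rw [h6 b hb.ne, h3 b (by omega), h1 b hb], ?_⟩
  rw [h5, ho]
  simp only [RExpr.eval]
  rw [h4, h3 M (by omega), h2]

theorem Comp.add {E E' : Γ.X → ℤ} (h : Comp Γ E) (h' : Comp Γ E') : Comp Γ fun x => E x + E' x :=
  h.binary h' .add (· + ·) fun _ _ _ => rfl

theorem Comp.sub {E E' : Γ.X → ℤ} (h : Comp Γ E) (h' : Comp Γ E') : Comp Γ fun x => E x - E' x :=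
  h.binary h' .sub (· - ·) fun _ _ _ => rfl

open Classical in
theorem Comp.ite_pos {E F F' : Γ.X → ℤ} (h : Comp Γ E) (hF : Comp Γ F) (hF' : Comp Γ F') :
    Comp Γ fun x => if 0 < E x then F x else F' x := by
  intro loc M hM hloc
  obtain ⟨P, q, hP⟩ := h loc M hM hloc
  obtain ⟨P1, q1, hP1⟩ := hF loc M hM hloc
  obtain ⟨P2, q2, hP2⟩ := hF' loc M hM hloc
  refine ⟨.seq P (.ite (.cell M) P1 P2), q + (3 + (q1 + q2)), fun x hx s hs => ((hP x hx s hs).seq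
    (T' := 3 + (q1.eval (Γ.n x) + q2.eval (Γ.n x))) ?_).mono
    (by simp) fun _ => id⟩
  rintro s1 ⟨h1, h2⟩
  refine Runs.ite (fun hc => ?_) (fun hc => ?_)
  · beta_reduce
    rw [if_pos (by simpa only [RExpr.eval, h2] using hc)]
    exact (hP1 x hx s1 (hs.congr hM hloc h1)).mono le_rfl
      fun s' h => ⟨fun a ha => (h.1 a ha).trans (h1 a ha), h.2⟩
  · beta_reduce
    rw [if_neg (by simpa only [RExpr.eval, h2] using hc)]
    exact (hP2 x hx s1 (hs.congr hM hloc h1)).mono le_rfl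
      fun s' h => ⟨fun a ha => (h.1 a ha).trans (h1 a ha), h.2⟩

/-- The natural number `e` is computable in polynomial time and bounded by a polynomial. -/
structure CompN (Γ : Ctx) (e : Γ.X → ℕ) : Prop where
  comp : Comp Γ fun x => (e x : ℤ)
  bound : ∃ q : Polynomial ℕ, ∀ x, Γ.Valid x → e x ≤ q.eval (Γ.n x)

/-- Sums with a number of terms that is bounded by a polynomial. -/
theorem Comp.sum {N : Γ.X → ℕ} (hN : CompN Γ N) {F : Γ.X → ℕ → ℤ}
    (hF : Comp (Γ.ext N) fun p => F p.1 p.2) :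
    Comp Γ fun x => ∑ i ∈ Finset.range (N x), F x i := by
  intro loc M hM hloc
  obtain ⟨b, hb⟩ := hN.bound
  obtain ⟨P, q, hP⟩ := hN.comp loc (M + 1) (by omega) fun i => (hloc i).trans (by omega)
  have hloc' : ∀ i : Option Γ.ι, i.elim (M + 2) loc < M + 3 := by
    rintro (_ | i)
    · simp
    · exact (hloc i).trans (by omega)
  obtain ⟨P', q', hP'⟩ := hF (fun i => i.elim (M + 2) loc) (M + 3) (by omega) hloc'
  -- The limit is in the array `M + 1`, the counter in `M + 2`, the current term in `M + 3`.
  let body : Program := .seq P' (.seq (.setCell M (.add (.cell M) (.cell (M + 3))))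
    (.setCell (M + 2) (.add (.cell (M + 2)) (.const 1))))
  refine ⟨.seq P (.seq (.setCell M (.const 0)) (.seq (.setCell (M + 2) (.const 0))
    (.loop (.sub (.cell (M + 1)) (.cell (M + 2))) body))),
    q + (3 + (3 + (b * (6 + (q' + (7 + 6))) + 6))), fun x hx s hs => ?_⟩
  refine ((hP x hx s hs).seq (T' := 3 + (3 + (N x * (6 + (q'.eval (Γ.n x) + (7 + 6))) + 6)))
    ?_).mono ?_ fun _ => id
  · rintro s1 ⟨h1, h2⟩
    refine Runs.seq (T := 3) (Q := fun s2 => s2 M 0 = 0 ∧ ∀ b ≠ M, s2 b = s1 b)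
      (Runs.setCell fun s2 h3 h4 => ⟨h3, h4⟩) ?_
    rintro s2 ⟨h3, h4⟩
    refine Runs.seq (T := 3) (Q := fun s3 => s3 (M + 2) 0 = 0 ∧ ∀ b ≠ M + 2, s3 b = s2 b)
      (Runs.setCell fun s3 h5 h6 => ⟨h5, h6⟩) ?_
    rintro s3 ⟨h5, h6⟩
    refine (Runs.loop (N := N x) (T := q'.eval (Γ.n x) + (7 + 6)) (fun i s' =>
      (∀ a < M, s' a = s a) ∧ s' M 0 = ∑ j ∈ Finset.range i, F x j ∧ s' (M + 1) 0 = N x ∧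
        s' (M + 2) 0 = i) ?_ ?_ ?_).mono le_rfl ?_
    · rintro i hi s' ⟨_, _, g3, g4⟩
      simp only [RExpr.eval, g3, g4]
      omega
    · rintro i hi s' ⟨g1, g2, g3, g4⟩
      refine (hP' (x, i) ⟨hx, hi⟩ s' ⟨fun a ha => ?_, ?_⟩).seq ?_
      · rw [g1 a (by omega)]
        exact hs.1 a ha
      · rintro (_ | j)
        · exact g4
        · exact (congrFun (g1 _ (hloc j)) 0).trans (hs.2 j)
      rintro s4 ⟨k1, k2⟩
      refine Runs.seq (T := 7) (Q := fun s5 => s5 M 0 = ∑ j ∈ Finset.range (i + 1), F x j ∧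
        ∀ b ≠ M, s5 b = s4 b) ?_ ?_
      · refine Runs.setCell fun s5 l1 l2 => ⟨?_, l2⟩
        rw [l1, Finset.sum_range_succ]
        simp only [RExpr.eval]
        rw [k2, k1 M (by omega), g2]
      · rintro s5 ⟨l1, l2⟩
        refine (Runs.setCell fun s6 m1 m2 => ?_).mono (by simp [RExpr.cost]) fun _ => id
        refine ⟨fun a ha => ?_, ?_, ?_, ?_⟩
        · rw [m2 a (by omega), l2 a (by omega), k1 a (by omega), g1 a ha]
        · rw [m2 M (by omega), l1]
        · rw [m2 _ (by omega), l2 _ (by omega), k1 _ (by omega), g3]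
        · rw [m1]
          simp only [RExpr.eval]
          rw [l2 _ (by omega), k1 _ (by omega), g4]
          push_cast
          ring
    · refine ⟨fun a ha => ?_, ?_, ?_, ?_⟩
      · rw [h6 a (by omega), h4 a (by omega), h1 a (by omega)]
      · rw [h6 M (by omega), h3]
        simp
      · rw [h6 _ (by omega), h4 _ (by omega), h2]
      · rw [h5]
        simp
    · rintro s' ⟨g1, g2, _, _⟩
      exact ⟨g1, g2⟩
  · have := Nat.mul_le_mul_right (6 + (q'.eval (Γ.n x) + (7 + 6))) (hb x hx)
    simp only [Polynomial.eval_add, Polynomial.eval_mul, Polynomial.eval_ofNat]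
    omega

/-! ### Predicates and arithmetic -/

open Classical in
/-- The predicate `p` is decidable in polynomial time. -/
def CompP (Γ : Ctx) (p : Γ.X → Prop) : Prop := Comp Γ fun x => if p x then 1 else 0

theorem CompP.congr {p p' : Γ.X → Prop} (h : CompP Γ p) (hp : ∀ x, Γ.Valid x → (p' x ↔ p x)) :
    CompP Γ p' :=
  Comp.congr h fun x hx => by
    have := hp x hx
    by_cases h : p x <;> simp [this, h]

theorem CompP.indicator {p : Γ.X → Prop} [∀ x, Decidable (p x)] (h : CompP Γ p) :
    Comp Γ fun x => if p x then 1 else 0 :=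
  Comp.congr h fun x _ => by by_cases hp : p x <;> simp [hp]

theorem Comp.pos {E : Γ.X → ℤ} (h : Comp Γ E) : CompP Γ fun x => 0 < E x :=
  (h.ite_pos (Comp.const 1) (Comp.const 0)).congr fun x _ => by by_cases hp : 0 < E x <;> simp [hp]

theorem CompP.ite {p : Γ.X → Prop} [∀ x, Decidable (p x)] (h : CompP Γ p) {E E' : Γ.X → ℤ}
    (hE : Comp Γ E) (hE' : Comp Γ E') : Comp Γ fun x => if p x then E x else E' x := by
  refine (Comp.ite_pos h hE hE').congr fun x _ => ?_
  by_cases hp : p x <;> simp [hp]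

theorem CompP.not {p : Γ.X → Prop} (h : CompP Γ p) : CompP Γ fun x => ¬ p x := by
  classical
  refine (h.ite (Comp.const 0) (Comp.const 1)).congr fun x _ => ?_
  by_cases hp : p x <;> simp [hp]

theorem CompP.and {p p' : Γ.X → Prop} (h : CompP Γ p) (h' : CompP Γ p') :
    CompP Γ fun x => p x ∧ p' x := by
  classical
  refine (h.ite h' (Comp.const 0)).congr fun x _ => ?_
  by_cases hp : p x <;> simp [hp]

theorem CompP.or {p p' : Γ.X → Prop} (h : CompP Γ p) (h' : CompP Γ p') :
    CompP Γ fun x => p x ∨ p' x := by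
  classical
  refine (h.ite (Comp.const 1) h').congr fun x _ => ?_
  by_cases hp : p x <;> simp [hp]

theorem CompP.imp {p p' : Γ.X → Prop} (h : CompP Γ p) (h' : CompP Γ p') :
    CompP Γ fun x => p x → p' x :=
  (h.not.or h').congr fun _ _ => imp_iff_not_or

theorem CompP.true : CompP Γ fun _ => True := (Comp.const 1).congr fun _ _ => by simp

theorem CompN.lt {e e' : Γ.X → ℕ} (h : CompN Γ e) (h' : CompN Γ e') :
    CompP Γ fun x => e x < e' x :=
  (h'.comp.sub h.comp).pos.congr fun _ _ => by omega

theorem CompN.le {e e' : Γ.X → ℕ} (h : CompN Γ e) (h' : CompN Γ e') :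
    CompP Γ fun x => e x ≤ e' x :=
  (h'.lt h).not.congr fun _ _ => by omega

theorem CompN.eq {e e' : Γ.X → ℕ} (h : CompN Γ e) (h' : CompN Γ e') :
    CompP Γ fun x => e x = e' x :=
  ((h.le h').and (h'.le h)).congr fun _ _ => by omega

theorem CompP.exists_lt {N : Γ.X → ℕ} (hN : CompN Γ N) {p : Γ.X → ℕ → Prop}
    (h : CompP (Γ.ext N) fun y => p y.1 y.2) : CompP Γ fun x => ∃ i < N x, p x i := by
  classical
  refine (Comp.sum hN (F := fun x i => if p x i then 1 else 0) h.indicator).pos.congr fun x _ => ?_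
  simp [Finset.filter_nonempty_iff]

theorem CompP.forall_lt {N : Γ.X → ℕ} (hN : CompN Γ N) {p : Γ.X → ℕ → Prop}
    (h : CompP (Γ.ext N) fun y => p y.1 y.2) : CompP Γ fun x => ∀ i < N x, p x i :=
  (CompP.exists_lt hN (p := fun x i => ¬ p x i) h.not).not.congr fun x _ => by push Not; rfl

theorem CompP.exists_fin : ∀ {K : ℕ} {p : Fin K → Γ.X → Prop}, (∀ i, CompP Γ (p i)) →
    CompP Γ fun x => ∃ i, p i x
  | 0, _, _ => CompP.true.not.congr fun _ _ => by simp
  | _ + 1, _, h => ((h 0).or (exists_fin fun i => h i.succ)).congr fun _ _ => Fin.exists_fin_succ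

theorem CompP.forall_fin {K : ℕ} {p : Fin K → Γ.X → Prop} (h : ∀ i, CompP Γ (p i)) :
    CompP Γ fun x => ∀ i, p i x :=
  (CompP.exists_fin fun i => (h i).not).not.congr fun x _ => by push Not; rfl

theorem CompN.congr {e e' : Γ.X → ℕ} (h : CompN Γ e) (he : ∀ x, Γ.Valid x → e' x = e x) :
    CompN Γ e' :=
  ⟨h.comp.congr fun x hx => by rw [he x hx],
    h.bound.imp fun q hq x hx => (he x hx).le.trans (hq x hx)⟩

/-- A number that is at most one with a polynomial bound has a polynomial bound. -/
theorem CompN.of_le {e b : Γ.X → ℕ} (h : Comp Γ fun x => (e x : ℤ)) (hb : CompN Γ b)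
    (hle : ∀ x, Γ.Valid x → e x ≤ b x) : CompN Γ e :=
  ⟨h, hb.bound.imp fun _ hq x hx => (hle x hx).trans (hq x hx)⟩

theorem CompN.const (c : ℕ) : CompN Γ fun _ => c :=
  ⟨Comp.const c, .C c, fun _ _ => by simp⟩

theorem CompN.order : CompN Γ Γ.n :=
  ⟨((Comp.const 0).input (a := 0) (by omega)).congr fun x _ => by simp [inputStore, Ctx.n],
    .X, fun _ _ => by simp⟩

theorem CompN.weaken {e : Γ.X → ℕ} (h : CompN Γ e) (N : Γ.X → ℕ) :
    CompN (Γ.ext N) fun y => e y.1 :=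
  ⟨h.comp.weaken N, h.bound.imp fun _ hq x hx => hq x.1 hx.1⟩

theorem CompN.last {N : Γ.X → ℕ} (h : CompN Γ N) : CompN (Γ.ext N) fun y => y.2 :=
  ⟨Comp.last N, h.bound.imp fun _ hq x hx => hx.2.le.trans (hq x.1 hx.1)⟩

theorem CompN.add {e e' : Γ.X → ℕ} (h : CompN Γ e) (h' : CompN Γ e') :
    CompN Γ fun x => e x + e' x := by
  obtain ⟨q, hq⟩ := h.bound
  obtain ⟨q', hq'⟩ := h'.bound
  exact ⟨(h.comp.add h'.comp).congr fun _ _ => by push_cast; rfl, q + q',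
    fun x hx => by simpa using add_le_add (hq x hx) (hq' x hx)⟩

theorem CompN.ite {p : Γ.X → Prop} [∀ x, Decidable (p x)] (h : CompP Γ p) {e e' : Γ.X → ℕ}
    (he : CompN Γ e) (he' : CompN Γ e') : CompN Γ fun x => if p x then e x else e' x :=
  CompN.of_le ((h.ite he.comp he'.comp).congr fun _ _ => by split_ifs <;> rfl) (he.add he')
    fun _ _ => by split_ifs <;> simp

theorem CompN.mul_int {e : Γ.X → ℕ} (h : CompN Γ e) {E : Γ.X → ℤ} (hE : Comp Γ E) :
    Comp Γ fun x => (e x : ℤ) * E x :=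
  (Comp.sum h (F := fun x _ => E x) (hE.weaken e)).congr fun _ _ => by simp

theorem CompN.mul {e e' : Γ.X → ℕ} (h : CompN Γ e) (h' : CompN Γ e') :
    CompN Γ fun x => e x * e' x := by
  obtain ⟨q, hq⟩ := h.bound
  obtain ⟨q', hq'⟩ := h'.bound
  exact ⟨(h.mul_int h'.comp).congr fun _ _ => by push_cast; rfl, q * q',
    fun x hx => by simpa using Nat.mul_le_mul (hq x hx) (hq' x hx)⟩

theorem CompN.pow {e : Γ.X → ℕ} (h : CompN Γ e) : ∀ c : ℕ, CompN Γ fun x => e x ^ c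
  | 0 => (CompN.const 1).congr fun _ _ => pow_zero _
  | c + 1 => ((h.pow c).mul h).congr fun _ _ => pow_succ _ _

theorem CompN.eval (q : Polynomial ℕ) : CompN Γ fun x => q.eval (Γ.n x) := by
  induction q using Polynomial.induction_on' with
  | add q q' h h' => exact (h.add h').congr fun _ _ => by simp
  | monomial c a => exact ((CompN.const a).mul (CompN.order.pow c)).congr fun _ _ => by simp

theorem CompN.div {e e' : Γ.X → ℕ} (h : CompN Γ e) (h' : CompN Γ e')
    (hpos : ∀ x, Γ.Valid x → 0 < e' x) : CompN Γ fun x => e x / e' x := by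
  classical
  refine CompN.of_le ?_ h fun _ _ => Nat.div_le_self _ _
  refine (Comp.sum h (F := fun x i => if (i + 1) * e' x ≤ e x then 1 else 0)
    (((h.last.add (CompN.const 1)).mul (h'.weaken e)).le (h.weaken e)).indicator).congr fun x hx => ?_
  have : (Finset.range (e x)).filter (fun i => (i + 1) * e' x ≤ e x)
      = Finset.range (e x / e' x) := by
    ext i
    have := Nat.le_div_iff_mul_le (x := i + 1) (y := e x) (hpos x hx)
    have := Nat.div_le_self (e x) (e' x)
    simp only [Finset.mem_filter, Finset.mem_range]
    omega
  rw [Finset.sum_boole, this, Finset.card_range]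

theorem CompN.mod {e e' : Γ.X → ℕ} (h : CompN Γ e) (h' : CompN Γ e')
    (hpos : ∀ x, Γ.Valid x → 0 < e' x) : CompN Γ fun x => e x % e' x :=
  CompN.of_le ((h.comp.sub (h'.mul (h.div h' hpos)).comp).congr fun x _ => by
    have := Nat.div_add_mod (e x) (e' x)
    zify at this
    push_cast
    linarith) h fun _ _ => Nat.mod_le _ _

theorem CompN.pair {e e' : Γ.X → ℕ} (h : CompN Γ e) (h' : CompN Γ e') :
    CompN Γ fun x => Nat.pair (e x) (e' x) :=
  CompN.ite (h.lt h') ((h'.mul h').add h) (((h.mul h).add h).add h')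

theorem CompN.sum_fin : ∀ {K : ℕ} {e : Fin K → Γ.X → ℕ}, (∀ i, CompN Γ (e i)) →
    CompN Γ fun x => ∑ i, e i x
  | 0, _, _ => (CompN.const 0).congr fun _ _ => by simp
  | _ + 1, _, h => ((h 0).add (sum_fin fun i => h i.succ)).congr fun _ _ => Fin.sum_univ_succ _

/-! ### Reading the instance -/

/-- Adjacency in the graph of an instance, as a relation on natural numbers. -/
def Inst.Adj (I : Inst) (u v : ℕ) : Prop :=
  ∃ (hu : u < I.n) (hv : v < I.n), I.graph.Adj ⟨u, hu⟩ ⟨v, hv⟩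

/-- The table of the values `f_i(d)` of an instance, as a function on natural numbers. For `d ≥ n`
the value has no meaning. -/
noncomputable def Inst.val (I : Inst) (u d : ℕ) : ℤ := matrixArray I.cost (u * I.n + d)

theorem matrixArray_apply {n : ℕ} (A : Fin n → Fin n → ℤ) (i j : Fin n) :
    matrixArray A ((i : ℤ) * n + j) = A i j := by
  have key : ∀ i' j' : Fin n, ((i : ℤ) * n + j = (i' : ℤ) * n + j') ↔ i = i' ∧ j = j' := by
    intro i' j'
    refine ⟨fun h => ?_, by rintro ⟨rfl, rfl⟩; rfl⟩
    have h' : (i : ℕ) * n + j = i' * n + j' := by exact_mod_cast h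
    have hn : 0 < n := i.pos
    have h1 := congrArg (· / n) h'
    have h2 := congrArg (· % n) h'
    simp only [Nat.mul_add_mod_of_lt j.2, Nat.mul_add_mod_of_lt j'.2] at h2
    simp only [Nat.mul_comm _ n, Nat.mul_add_div hn, Nat.div_eq_of_lt j.2,
      Nat.div_eq_of_lt j'.2] at h1
    exact ⟨Fin.ext (by simpa using h1), Fin.ext h2⟩
  unfold matrixArray
  simp only [key, ite_and]
  simp

theorem CompN.val {e e' : Γ.X → ℕ} (h : CompN Γ e) (h' : CompN Γ e') :
    Comp Γ fun x => (Γ.inst x).val (e x) (e' x) :=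
  (((h.mul CompN.order).add h').comp.input (a := 2) (by omega)).congr fun x _ => by
    simp [inputStore, Inst.val, Ctx.n]

theorem CompN.adj {e e' : Γ.X → ℕ} (h : CompN Γ e) (h' : CompN Γ e') :
    CompP Γ fun x => (Γ.inst x).Adj (e x) (e' x) := by
  classical
  refine ((h.lt CompN.order).and ((h'.lt CompN.order).and
    (((h.mul CompN.order).add h').comp.input (a := 1) (by omega)).pos)).congr fun x _ => ?_
  constructor
  · rintro ⟨hu, hv, ha⟩
    refine ⟨hu, hv, ?_⟩
    have := matrixArray_apply (fun i j => if (Γ.inst x).graph.Adj i j then 1 else 0)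
      ⟨e x, hu⟩ ⟨e' x, hv⟩
    simp only [inputStore]
    push_cast
    rw [this, if_pos ha]
    simp
  · rintro ⟨hu, hv, ha⟩
    refine ⟨hu, hv, ?_⟩
    have := matrixArray_apply (fun i j => if (Γ.inst x).graph.Adj i j then 1 else 0)
      ⟨e x, hu⟩ ⟨e' x, hv⟩
    simp only [inputStore] at ha
    push_cast at ha
    rw [this] at ha
    by_contra hn
    rw [if_neg hn] at ha
    simp at ha

/-! ### Tables filled by relaxation -/

/-- A rule deriving an upper bound for the entry `head` of a table from the entries `fst` and `snd`:
if `ok` holds then `head` may get the value `fst + snd + weight`. -/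
structure Rule where
  ok : Prop
  head : ℕ
  fst : ℕ
  snd : ℕ
  weight : ℤ

/-- The rule has its side condition satisfied and leads to the value `v` for its head. -/
def Rule.Fires (R : Rule) (τ : ℕ → Option ℤ) (v : ℤ) : Prop :=
  R.ok ∧ ∃ a b, τ R.fst = some a ∧ τ R.snd = some b ∧ v = a + b + R.weight

/-- The rule leads to a value for its head that is better than the present one, if any. -/
def Rule.Improves (R : Rule) (τ : ℕ → Option ℤ) (v : ℤ) : Prop :=
  R.Fires τ v ∧ ∀ v', τ R.head = some v' → v < v'

open Classical in
/-- The table after the application of a rule. -/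
noncomputable def Rule.relax (R : Rule) (τ : ℕ → Option ℤ) : ℕ → Option ℤ :=
  if h : ∃ v, R.Improves τ v then Function.update τ R.head (some h.choose) else τ

/-- The table after applying the rules `R 0, …, R (c - 1)` to the table whose only entry is `0` at
the index `e`. -/
noncomputable def table (e : ℕ) (R : ℕ → Rule) : ℕ → ℕ → Option ℤ
  | 0 => Function.update (fun _ => none) e (some 0)
  | c + 1 => (R c).relax (table e R c)

theorem Rule.Fires.unique {R : Rule} {τ : ℕ → Option ℤ} {v v' : ℤ} (h : R.Fires τ v)
    (h' : R.Fires τ v') : v = v' := by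
  obtain ⟨_, a, b, ha, hb, rfl⟩ := h
  obtain ⟨_, a', b', ha', hb', rfl⟩ := h'
  rw [ha] at ha'
  rw [hb] at hb'
  cases ha'
  cases hb'
  rfl

theorem Rule.relax_of_improves {R : Rule} {τ : ℕ → Option ℤ} {v : ℤ} (h : R.Improves τ v) :
    R.relax τ = Function.update τ R.head (some v) := by
  have h' : ∃ v, R.Improves τ v := ⟨v, h⟩
  rw [Rule.relax, dif_pos h', h'.choose_spec.1.unique h.1]

theorem Rule.relax_of_not {R : Rule} {τ : ℕ → Option ℤ} (h : ¬ ∃ v, R.Improves τ v) :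
    R.relax τ = τ := dif_neg h

theorem Rule.relax_sound {R : Rule} {τ : ℕ → Option ℤ} {S : ℕ → ℤ → Prop}
    (hτ : ∀ i v, τ i = some v → S i v)
    (hR : ∀ a b, R.ok → S R.fst a → S R.snd b → S R.head (a + b + R.weight)) :
    ∀ i v, R.relax τ i = some v → S i v := by
  intro i v hi
  by_cases h : ∃ v, R.Improves τ v
  · obtain ⟨v', h⟩ := h
    rw [relax_of_improves h] at hi
    by_cases hh : i = R.head
    · subst hh
      obtain ⟨⟨hok, a, b, ha, hb, rfl⟩, -⟩ := h
      simp only [Function.update_self, Option.some.injEq] at hi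
      exact hi ▸ hR a b hok (hτ _ _ ha) (hτ _ _ hb)
    · rw [Function.update_of_ne hh] at hi
      exact hτ _ _ hi
  · rw [relax_of_not h] at hi
    exact hτ _ _ hi

/-- Every entry of the table satisfies a predicate that holds for the initial entry and is closed
under the rules. -/
theorem table_sound {e : ℕ} {R : ℕ → Rule} {S : ℕ → ℤ → Prop} (h0 : S e 0)
    (hR : ∀ c a b, (R c).ok → S (R c).fst a → S (R c).snd b →
      S (R c).head (a + b + (R c).weight)) :
    ∀ c i v, table e R c i = some v → S i v
  | 0, i, v, h => by
    by_cases hi : i = e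
    · subst hi
      simp only [table, Function.update_self, Option.some.injEq] at h
      exact h ▸ h0
    · simp [table, Function.update_of_ne hi] at h
  | c + 1, i, v, h => Rule.relax_sound (table_sound h0 hR c) (hR c) i v h

/-- The table has an entry with value at most `v` at the index `i`. -/
def AtMost (τ : ℕ → Option ℤ) (i : ℕ) (v : ℤ) : Prop := ∃ v' ≤ v, τ i = some v'

theorem AtMost.relax {R : Rule} {τ : ℕ → Option ℤ} {i : ℕ} {v : ℤ} (h : AtMost τ i v) :
    AtMost (R.relax τ) i v := by
  by_cases hi : ∃ v, R.Improves τ v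
  · obtain ⟨u, hi⟩ := hi
    rw [AtMost, Rule.relax_of_improves hi]
    obtain ⟨v', hv', h⟩ := h
    by_cases hh : i = R.head
    · subst hh
      exact ⟨u, (hi.2 v' h).le.trans hv', by simp⟩
    · exact ⟨v', hv', by rw [Function.update_of_ne hh, h]⟩
  · rwa [Rule.relax_of_not hi]

theorem AtMost.relax_head {R : Rule} {τ : ℕ → Option ℤ} {a b : ℤ} (hok : R.ok)
    (ha : AtMost τ R.fst a) (hb : AtMost τ R.snd b) :
    AtMost (R.relax τ) R.head (a + b + R.weight) := by
  obtain ⟨a', ha', ha⟩ := ha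
  obtain ⟨b', hb', hb⟩ := hb
  by_cases hi : ∃ v, R.Improves τ v
  · obtain ⟨u, hi⟩ := hi
    have : u = a' + b' + R.weight := hi.1.unique ⟨hok, a', b', ha, hb, rfl⟩
    exact ⟨u, by omega, by rw [Rule.relax_of_improves hi, Function.update_self]⟩
  · rw [Rule.relax_of_not hi]
    have : ¬ ∀ v', τ R.head = some v' → a' + b' + R.weight < v' := fun h =>
      hi ⟨_, ⟨hok, a', b', ha, hb, rfl⟩, h⟩
    push Not at this
    obtain ⟨v', h1, h2⟩ := this
    exact ⟨v', by omega, h1⟩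

theorem AtMost.table_mono {e : ℕ} {R : ℕ → Rule} {c c' i : ℕ} {v : ℤ} (hc : c ≤ c')
    (h : AtMost (table e R c) i v) : AtMost (table e R c') i v := by
  induction hc with
  | refl => exact h
  | step _ ih => exact ih.relax

/-- A rule that occurs between two stages of the table is effective. -/
theorem AtMost.table_rule {e : ℕ} {R : ℕ → Rule} {c₀ c c₁ : ℕ} {a b : ℤ} (h₀ : c₀ ≤ c) (h₁ : c < c₁)
    (hok : (R c).ok) (ha : AtMost (table e R c₀) (R c).fst a)
    (hb : AtMost (table e R c₀) (R c).snd b) :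
    AtMost (table e R c₁) (R c).head (a + b + (R c).weight) :=
  AtMost.table_mono (c := c + 1) h₁ (.relax_head hok (ha.table_mono h₀) (hb.table_mono h₀))

/-- The arrays `F` and `F + 1` hold the part of the table below `L`: the array `F` tells whether
there is an entry, and the array `F + 1` its value. -/
def Holds (s : Store) (F L : ℕ) (τ : ℕ → Option ℤ) : Prop :=
  ∀ i < L, s F i = (if (τ i).isSome then 1 else 0) ∧ s (F + 1) i = (τ i).getD 0

/-- Adding an entry to a table. -/
theorem Holds.update {s s' : Store} {F L : ℕ} {τ : ℕ → Option ℤ} (h : Holds s F L τ) (i : ℕ)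
    (v : ℤ) (h1 : s' F = (s.set F i 1) F) (h2 : s' (F + 1) = (s.set (F + 1) i v) (F + 1)) :
    Holds s' F L (Function.update τ i (some v)) := by
  intro j hj
  rw [h1, h2]
  by_cases hji : j = i
  · subst hji
    simp [Store.set_same]
  · have := h j hj
    simp [Store.set, hji, this]

/-- The program that applies one rule to the table in the arrays `F` and `F + 1`, when its side
condition (as a positive number), head, premises and weight are in the arrays from `B` on. -/
def relaxProgram (F B : ℕ) : Program :=
  .ite (.cell B) (.ite (.read F (.cell (B + 2))) (.ite (.read F (.cell (B + 3)))
    (.seq (.setCell (B + 5) (.add (.add (.read (F + 1) (.cell (B + 2)))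
        (.read (F + 1) (.cell (B + 3)))) (.cell (B + 4))))
      (.ite (.read F (.cell (B + 1)))
        (.ite (.sub (.read (F + 1) (.cell (B + 1))) (.cell (B + 5)))
          (.write (F + 1) (.cell (B + 1)) (.cell (B + 5))) .skip)
        (.seq (.write F (.cell (B + 1)) (.const 1))
          (.write (F + 1) (.cell (B + 1)) (.cell (B + 5)))))) .skip) .skip) .skip

/-- The bound `100` on the number of steps is generous. -/
theorem relaxProgram_runs {s : Store} {F B L : ℕ} {τ : ℕ → Option ℤ} {R : Rule} {ok : ℤ}
    (h : Holds s F L τ) (hB : F + 1 < B) (hok : s B 0 = ok) (hok' : 0 < ok ↔ R.ok)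
    (hh : s (B + 1) 0 = R.head)
    (h1 : s (B + 2) 0 = R.fst) (h2 : s (B + 3) 0 = R.snd) (hw : s (B + 4) 0 = R.weight)
    (lh : R.head < L) (l1 : R.fst < L) (l2 : R.snd < L) :
    Runs (relaxProgram F B) s 100 fun s' =>
      (∀ a < B, a ≠ F → a ≠ F + 1 → s' a = s a) ∧ Holds s' F L (R.relax τ) := by
  -- In all branches without a write the rule does not improve the table.
  have stay : (¬ ∃ v, R.Improves τ v) → (∀ a < B, a ≠ F → a ≠ F + 1 → s a = s a) ∧
      Holds s F L (R.relax τ) := fun hn => ⟨fun _ _ _ _ => rfl, by rwa [Rule.relax_of_not hn]⟩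
  refine (Runs.ite (T := 54) (T' := 1) (fun c1 => ?_) (fun c1 => ?_)).mono (by simp [RExpr.cost]) fun _ => id
  swap
  · refine Runs.skip (stay ?_)
    rintro ⟨v, ⟨g1, -⟩, -⟩
    simp only [RExpr.eval, hok, hok'] at c1
    exact c1 g1
  simp only [RExpr.eval, hok, hok'] at c1
  refine (Runs.ite (T := 49) (T' := 1) (fun c2 => ?_) (fun c2 => ?_)).mono (by simp [RExpr.cost]) fun _ => id
  swap
  · refine Runs.skip (stay ?_)
    rintro ⟨v, ⟨-, a, b, ha, -⟩, -⟩
    simp [RExpr.eval, h1, (h _ l1).1, ha] at c2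
  simp only [RExpr.eval, h1, (h _ l1).1] at c2
  refine (Runs.ite (T := 44) (T' := 1) (fun c3 => ?_) (fun c3 => ?_)).mono (by simp [RExpr.cost]) fun _ => id
  swap
  · refine Runs.skip (stay ?_)
    rintro ⟨v, ⟨-, a, b, -, hb, -⟩, -⟩
    simp [RExpr.eval, h2, (h _ l2).1, hb] at c3
  simp only [RExpr.eval, h2, (h _ l2).1] at c3
  obtain ⟨a, ha⟩ : ∃ a, τ R.fst = some a := by
    cases hx : τ R.fst with
    | none => simp [hx] at c2
    | some a => exact ⟨a, rfl⟩
  obtain ⟨b, hb⟩ : ∃ b, τ R.snd = some b := by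
    cases hx : τ R.snd with
    | none => simp [hx] at c3
    | some b => exact ⟨b, rfl⟩
  have hf : R.Fires τ (a + b + R.weight) := ⟨c1, a, b, ha, hb, rfl⟩
  refine Runs.seq (T := 12) (T' := 32) (Q := fun s1 => s1 (B + 5) 0 = a + b + R.weight ∧ ∀ c ≠ B + 5, s1 c = s c)
    ?_ ?_
  · refine (Runs.setCell fun s1 g1 g2 => ⟨?_, g2⟩).mono (by simp [RExpr.cost]) fun _ => id
    rw [g1]
    simp [RExpr.eval, h1, h2, hw, (h _ l1).2, (h _ l2).2, ha, hb]
  rintro s1 ⟨g1, g2⟩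
  have hs1 : Holds s1 F L τ := fun i hi => by
    rw [g2 F (by omega), g2 (F + 1) (by omega)]
    exact h i hi
  have e1 : s1 (B + 1) 0 = R.head := by rw [g2 _ (by omega), hh]
  refine (Runs.ite (T := 13) (T' := 9) (fun c4 => ?_) (fun c4 => ?_)).mono (by simp [RExpr.cost]) fun _ => id
  · obtain ⟨v', hv'⟩ : ∃ v', τ R.head = some v' := by
      cases hx : τ R.head with
      | none => simp [RExpr.eval, e1, (hs1 _ lh).1, hx] at c4
      | some b => exact ⟨b, rfl⟩
    refine (Runs.ite (T := 5) (T' := 1) (fun c5 => ?_) (fun c5 => ?_)).mono (by simp [RExpr.cost]) fun _ => id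
    · simp only [RExpr.eval, e1, (hs1 _ lh).2, hv', g1, Option.getD_some, sub_pos] at c5
      refine (Runs.write ?_).mono (by simp [RExpr.cost]) fun _ => id
      simp only [RExpr.eval, e1, g1]
      refine ⟨fun c hc hF hF' => by rw [Store.set_array _ _ _ hF', g2 c (by omega)], ?_⟩
      have hi : R.Improves τ (a + b + R.weight) := ⟨hf, fun v'' hv'' => by
        rw [hv'] at hv''
        cases hv''
        exact c5⟩
      rw [Rule.relax_of_improves hi]
      refine hs1.update _ _ ?_ rfl
      rw [Store.set_array _ _ _ (by omega)]
      funext z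
      by_cases hz : z = R.head
      · subst hz
        rw [Store.set_same, (hs1 _ lh).1, hv']
        rfl
      · simp [Store.set, hz]
    · refine Runs.skip ⟨fun c hc _ _ => g2 c (by omega), ?_⟩
      rw [Rule.relax_of_not]
      · exact hs1
      rintro ⟨v, hi1, hi2⟩
      have := hi1.unique hf
      have := hi2 v' hv'
      simp only [RExpr.eval, e1, (hs1 _ lh).2, hv', g1, Option.getD_some, sub_pos] at c5
      omega
  · have hn : τ R.head = none := by
      cases hx : τ R.head with
      | none => rfl
      | some b => simp [RExpr.eval, e1, (hs1 _ lh).1, hx] at c4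
    have hi : R.Improves τ (a + b + R.weight) := ⟨hf, fun v'' hv'' => by simp [hn] at hv''⟩
    rw [Rule.relax_of_improves hi]
    refine (Runs.seq (T := 4) (T' := 5) (Q := fun s2 => s2 = s1.set F R.head 1) (Runs.write ?_)
      (Q' := fun s3 => s3 = (s1.set F R.head 1).set (F + 1) R.head (a + b + R.weight)) ?_).mono
        (by simp) ?_
    · simp only [RExpr.eval, e1]
    · rintro s2 rfl
      refine Runs.write ?_
      simp only [RExpr.eval]
      rw [Store.set_array _ _ _ (by omega), Store.set_array _ _ _ (by omega), e1, g1]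
    · rintro s3 rfl
      refine ⟨fun c hc hF hF' => by
        rw [Store.set_array _ _ _ hF', Store.set_array _ _ _ hF, g2 c (by omega)], ?_⟩
      refine hs1.update _ _ ?_ ?_
      · rw [Store.set_array _ _ _ (by omega)]
      · funext z
        simp [Store.set]

/-- The constituents of a rule are computable in polynomial time. -/
structure CompRule (Γ : Ctx) (R : Γ.X → Rule) : Prop where
  ok : CompP Γ fun x => (R x).ok
  head : CompN Γ fun x => (R x).head
  fst : CompN Γ fun x => (R x).fst
  snd : CompN Γ fun x => (R x).snd
  weight : Comp Γ fun x => (R x).weight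

/-- The program that fills the arrays `F` and `F + 1` with zeros at the indices below `L`, where `L`
is in the array `C + 1` and the array `C` serves as a counter. -/
def clearProgram (C F : ℕ) : Program :=
  .seq (.setCell C (.const 0)) (.loop (.sub (.cell (C + 1)) (.cell C))
    (.seq (.write F (.cell C) (.const 0)) (.seq (.write (F + 1) (.cell C) (.const 0))
      (.setCell C (.add (.cell C) (.const 1))))))

theorem clearProgram_runs {s : Store} {C F L : ℕ} (hC : C + 1 < F) (hL : s (C + 1) 0 = L) :
    Runs (clearProgram C F) s (L * 30 + 9) fun s' =>
      (∀ a < C, s' a = s a) ∧ Holds s' F L fun _ => none := by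
  refine (Runs.seq (T := 3) (Q := fun s1 => s1 C 0 = 0 ∧ ∀ b ≠ C, s1 b = s b)
    (Runs.setCell fun s1 h1 h2 => ⟨h1, h2⟩) (T' := L * (6 + 24) + 6) ?_).mono (by omega) fun _ => id
  rintro s1 ⟨h1, h2⟩
  refine (Runs.loop (N := L) (T := 24) (fun i s' => (∀ a < C, s' a = s a) ∧ s' C 0 = i ∧
    s' (C + 1) 0 = L ∧ Holds s' F i fun _ => none) ?_ ?_ ?_).mono le_rfl ?_
  · rintro i hi s' ⟨-, g1, g2, -⟩
    simp only [RExpr.eval, g1, g2]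
    omega
  · rintro i hi s' ⟨g0, g1, g2, g3⟩
    refine (Runs.seq (Q := fun s2 => s2 = s'.set F i 0) (Runs.write ?_)
      ((fun s2 hs2 => Runs.seq (T' := 6) (Q := fun s3 => s3 = (s'.set F i 0).set (F + 1) i 0)
        (Runs.write ?_) ?_))).mono (by simp [RExpr.cost]) fun _ => id
    · simp only [RExpr.eval, g1]
    · simp only [RExpr.eval, hs2]
      rw [Store.set_array _ _ _ (by omega), g1]
    · rintro s3 rfl
      refine Runs.setCell fun s4 k1 k2 => ⟨fun a ha => ?_, ?_, ?_, ?_⟩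
      · rw [k2 a (by omega), Store.set_array _ _ _ (by omega), Store.set_array _ _ _ (by omega),
          g0 a ha]
      · rw [k1]
        simp only [RExpr.eval]
        rw [Store.set_array _ _ _ (by omega), Store.set_array _ _ _ (by omega), g1]
        simp
      · rw [k2 _ (by omega), Store.set_array _ _ _ (by omega), Store.set_array _ _ _ (by omega), g2]
      · intro j hj
        rw [k2 F (by omega), k2 (F + 1) (by omega)]
        by_cases hji : j = i
        · subst hji
          simp [Store.set]
        · have := g3 j (by omega)
          simpa [Store.set, hji] using this
  · refine ⟨fun a ha => h2 a (by omega), by simpa using h1, by rw [h2 _ (by omega), hL], ?_⟩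
    intro i hi
    omega
  · rintro s' ⟨g0, _, _, g3⟩
    exact ⟨g0, g3⟩

/-- A table filled by polynomially many rules is computable in polynomial time. -/
theorem exists_program_table {e N L : Γ.X → ℕ} {R : Γ.X → ℕ → Rule} (he : CompN Γ e)
    (hN : CompN Γ N) (hR : CompRule (Γ.ext N) fun y => R y.1 y.2) (hL : CompN Γ L)
    (heL : ∀ x, Γ.Valid x → e x < L x)
    (hRL : ∀ x, Γ.Valid x → ∀ c < N x, (R x c).head < L x ∧ (R x c).fst < L x ∧ (R x c).snd < L x)
    {loc : Γ.ι → ℕ} {M : ℕ} (hM : 3 ≤ M) (hloc : ∀ i, loc i < M) :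
    ∃ (P : Program) (q : Polynomial ℕ), ∀ x, Γ.Valid x → ∀ s, Γ.Rep loc s x →
      Runs P s (q.eval (Γ.n x)) fun s' => (∀ a < M, s' a = s a) ∧
        Holds s' (M + 2) (L x) (table (e x) (R x) (N x)) := by
  classical
  have hloc' : ∀ i, loc i < M + 4 := fun i => (hloc i).trans (by omega)
  have hlocx : ∀ d, ∀ i : Option Γ.ι, i.elim M loc < M + (4 + d) := by
    rintro d (_ | i)
    · simp
    · exact (hloc i).trans (by omega)
  obtain ⟨bL, hbL⟩ := hL.bound
  obtain ⟨bN, hbN⟩ := hN.bound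
  obtain ⟨PL, qL, hPL⟩ := hL.comp loc (M + 1) (by omega) fun i => (hloc i).trans (by omega)
  obtain ⟨Pe, qe, hPe⟩ := he.comp loc (M + 4) (by omega) hloc'
  obtain ⟨PN, qN, hPN⟩ := hN.comp loc (M + 4) (by omega) hloc'
  obtain ⟨P0, q0, hP0⟩ := hR.ok (fun i => i.elim M loc) (M + 4) (by omega) (hlocx 0)
  obtain ⟨P1, q1, hP1⟩ := hR.head.comp (fun i => i.elim M loc) (M + 5) (by omega) (hlocx 1)
  obtain ⟨P2, q2, hP2⟩ := hR.fst.comp (fun i => i.elim M loc) (M + 6) (by omega) (hlocx 2)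
  obtain ⟨P3, q3, hP3⟩ := hR.snd.comp (fun i => i.elim M loc) (M + 7) (by omega) (hlocx 3)
  obtain ⟨P4, q4, hP4⟩ := hR.weight (fun i => i.elim M loc) (M + 8) (by omega) (hlocx 4)
  -- The counter is in the array `M`, the limit in `M + 1`, the table in `M + 2` and `M + 3`.
  let body : Program := .seq P0 (.seq P1 (.seq P2 (.seq P3 (.seq P4 (.seq
    (relaxProgram (M + 2) (M + 4)) (.setCell M (.add (.cell M) (.const 1))))))))
  let main : Program := .seq PN (.seq (.setCell (M + 1) (.cell (M + 4)))
    (.seq (.setCell M (.const 0)) (.loop (.sub (.cell (M + 1)) (.cell M)) body)))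
  refine ⟨.seq PL (.seq (clearProgram M (M + 2)) (.seq Pe
    (.seq (.write (M + 2) (.cell (M + 4)) (.const 1)) main))),
    qL + ((bL * 30 + 9) + (qe + (4 + (qN + (4 + (3 +
      (bN * (6 + (q0 + (q1 + (q2 + (q3 + (q4 + (100 + 6))))))) + 6))))))),
    fun x hx s hs => ?_⟩
  refine ((hPL x hx s (hs.congr hM hloc fun _ _ => rfl)).seq (T' := (L x * 30 + 9) +
    (qe.eval (Γ.n x) + (4 + (qN.eval (Γ.n x) + (4 + (3 + (N x * (6 + (q0.eval (Γ.n x) +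
    (q1.eval (Γ.n x) + (q2.eval (Γ.n x) + (q3.eval (Γ.n x) + (q4.eval (Γ.n x)
      + (100 + 6))))))) + 6))))))) ?_).mono ?_ fun _ => id
  swap
  · have h1 := hbL x hx
    have h2 := Nat.mul_le_mul_right (6 + (q0.eval (Γ.n x) +
      (q1.eval (Γ.n x) + (q2.eval (Γ.n x) + (q3.eval (Γ.n x) + (q4.eval (Γ.n x)
      + (100 + 6))))))) (hbN x hx)
    simp only [Polynomial.eval_add, Polynomial.eval_mul, Polynomial.eval_ofNat]
    omega
  rintro s1 ⟨a1, b1⟩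
  refine (clearProgram_runs (by omega) b1).seq ?_
  rintro s2 ⟨a2, b2⟩
  have f2 : ∀ a < M, s2 a = s a := fun a ha => by rw [a2 a ha, a1 a (by omega)]
  refine (hPe x hx s2 (hs.congr hM hloc f2)).seq ?_
  rintro s3 ⟨a3, b3⟩
  refine Runs.seq (T := 4) (Q := fun s4 => (∀ a < M, s4 a = s a) ∧
    Holds s4 (M + 2) (L x) (table (e x) (R x) 0)) ?_ ?_
  · refine Runs.write ⟨fun a ha => ?_, ?_⟩
    · rw [Store.set_array _ _ _ (by omega), a3 a (by omega), f2 a ha]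
    · have h3 : Holds s3 (M + 2) (L x) fun _ => none := fun i hi => by
        rw [a3 _ (by omega), a3 _ (by omega)]
        exact b2 i hi
      simp only [RExpr.eval, b3]
      refine h3.update _ _ rfl ?_
      rw [Store.set_array _ _ _ (by omega)]
      funext z
      by_cases hz : z = e x
      · subst hz
        rw [Store.set_same, (h3 _ (heL x hx)).2]
        rfl
      · simp [Store.set, hz]
  rintro s4 ⟨a4, b4⟩
  refine (hPN x hx s4 (hs.congr hM hloc a4)).seq ?_
  rintro s5 ⟨a5, b5⟩
  refine Runs.seq (T := 4) (Q := fun s6 => s6 (M + 1) 0 = N x ∧ ∀ a ≠ M + 1, s6 a = s5 a)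
    (Runs.setCell fun s6 g1 g2 => ⟨g1.trans b5, g2⟩) ?_
  rintro s6 ⟨a6, b6⟩
  refine Runs.seq (T := 3) (Q := fun s7 => s7 M 0 = 0 ∧ ∀ a ≠ M, s7 a = s6 a)
    (Runs.setCell fun s7 g1 g2 => ⟨g1, g2⟩) ?_
  rintro s7 ⟨a7, b7⟩
  refine (Runs.loop (N := N x) (T := q0.eval (Γ.n x) +
      (q1.eval (Γ.n x) + (q2.eval (Γ.n x) + (q3.eval (Γ.n x) + (q4.eval (Γ.n x)
      + (100 + 6)))))) (fun c s' => (∀ a < M, s' a = s a) ∧ s' M 0 = c ∧ s' (M + 1) 0 = N x ∧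
        Holds s' (M + 2) (L x) (table (e x) (R x) c)) ?_ ?_ ?_).mono le_rfl ?_
  · rintro c hc s' ⟨-, g1, g2, -⟩
    simp only [RExpr.eval, g1, g2]
    omega
  · rintro c hc t0 ⟨g0, g1, g2, g3⟩
    have hv : (Γ.ext N).Valid (x, c) := ⟨hx, hc⟩
    have hrep : (Γ.ext N).Rep (fun i => i.elim M loc) t0 (x, c) := by
      refine ⟨fun a ha => ?_, ?_⟩
      · rw [g0 a (by omega)]
        exact hs.1 a ha
      · rintro (_ | j)
        · exact g1
        · exact (congrFun (g0 _ (hloc j)) 0).trans (hs.2 j)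
    refine (hP0 (x, c) hv t0 hrep).seq ?_
    rintro t1 ⟨k1, l1⟩
    refine (hP1 (x, c) hv t1 (hrep.congr (by omega) (hlocx 0) k1)).seq ?_
    rintro t2 ⟨k2, l2⟩
    replace k1 : ∀ a < M + 4, t2 a = t0 a := fun a ha => by rw [k2 a (by omega), k1 a ha]
    refine (hP2 (x, c) hv t2 (hrep.congr (by omega) (hlocx 0) k1)).seq ?_
    rintro t3 ⟨k3, l3⟩
    replace k1 : ∀ a < M + 4, t3 a = t0 a := fun a ha => by rw [k3 a (by omega), k1 a ha]
    refine (hP3 (x, c) hv t3 (hrep.congr (by omega) (hlocx 0) k1)).seq ?_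
    rintro t4 ⟨k4, l4⟩
    replace k1 : ∀ a < M + 4, t4 a = t0 a := fun a ha => by rw [k4 a (by omega), k1 a ha]
    refine (hP4 (x, c) hv t4 (hrep.congr (by omega) (hlocx 0) k1)).seq ?_
    rintro t5 ⟨k5, l5⟩
    replace k1 : ∀ a < M + 4, t5 a = t0 a := fun a ha => by rw [k5 a (by omega), k1 a ha]
    refine (relaxProgram_runs (R := R x c) (L := L x) (τ := table (e x) (R x) c)
      (ok := if (R x c).ok then 1 else 0) ?_ (by omega) ?_ ?_ ?_ ?_ ?_ ?_
      (hRL x hx c hc).1 (hRL x hx c hc).2.1 (hRL x hx c hc).2.2).seq ?_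
    · intro i hi
      rw [k1 _ (by omega), k1 _ (by omega)]
      exact g3 i hi
    · rw [k5 _ (by omega), k4 _ (by omega), k3 _ (by omega), k2 _ (by omega), l1]
    · split_ifs with h <;> simp [h]
    · rw [k5 _ (by omega), k4 _ (by omega), k3 _ (by omega), l2]
    · rw [k5 _ (by omega), k4 _ (by omega), l3]
    · rw [k5 _ (by omega), l4]
    · rw [l5]
    rintro t6 ⟨k6, l6⟩
    refine Runs.setCell fun t7 k7 m7 => ⟨fun a ha => ?_, ?_, ?_, ?_⟩
    · rw [m7 a (by omega), k6 a (by omega) (by omega) (by omega), k1 a (by omega), g0 a ha]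
    · rw [k7]
      simp only [RExpr.eval]
      rw [k6 _ (by omega) (by omega) (by omega), k1 _ (by omega), g1]
      simp
    · rw [m7 _ (by omega), k6 _ (by omega) (by omega) (by omega), k1 _ (by omega), g2]
    · intro i hi
      rw [m7 _ (by omega), m7 _ (by omega)]
      exact l6 i hi
  · refine ⟨fun a ha => ?_, by simpa using a7, ?_, ?_⟩
    · rw [b7 a (by omega), b6 a (by omega), a5 a (by omega), a4 a ha]
    · rw [b7 _ (by omega), a6]
    · intro i hi
      rw [b7 _ (by omega), b7 _ (by omega), b6 _ (by omega), b6 _ (by omega), a5 _ (by omega),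
        a5 _ (by omega)]
      exact b4 i hi
  · rintro s' ⟨g0, _, _, g3⟩
    exact ⟨g0, g3⟩

/-- Reading a table filled by polynomially many rules. -/
theorem Comp.table {e i N : Γ.X → ℕ} {R : Γ.X → ℕ → Rule} (he : CompN Γ e) (hi : CompN Γ i)
    (hN : CompN Γ N) (hR : CompRule (Γ.ext N) fun y => R y.1 y.2) :
    (CompP Γ fun x => (table (e x) (R x) (N x) (i x)).isSome) ∧
      Comp Γ fun x => (table (e x) (R x) (N x) (i x)).getD 0 := by
  classical
  obtain ⟨be, hbe⟩ := he.bound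
  obtain ⟨bi, hbi⟩ := hi.bound
  obtain ⟨b0, hb0⟩ := hR.head.bound
  obtain ⟨b1, hb1⟩ := hR.fst.bound
  obtain ⟨b2, hb2⟩ := hR.snd.bound
  -- All indices in use are below a polynomial in `n`, up to which the arrays are cleared.
  have hL := CompN.eval (Γ := Γ) (be + bi + b0 + b1 + b2 + 1)
  have key : ∀ d, ∀ out : Γ.X → ℤ, (∀ x, Γ.Valid x → ∀ s M,
      Holds s (M + 2) ((be + bi + b0 + b1 + b2 + 1).eval (Γ.n x)) (DegSeq.table (e x) (R x) (N x)) →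
        s (M + 2 + d) (i x) = out x) → d < 2 → Comp Γ out := by
    intro d out hout hd loc M hM hloc
    have hloc' : ∀ i, loc i < M + 4 := fun i => (hloc i).trans (by omega)
    obtain ⟨P, q, hP⟩ := exists_program_table he hN hR hL (fun x hx => by
      have := hbe x hx
      simp only [Polynomial.eval_add, Polynomial.eval_one]
      omega) (fun x hx c hc => by
      have h0 := hb0 (x, c) ⟨hx, hc⟩
      have h1 := hb1 (x, c) ⟨hx, hc⟩
      have h2 := hb2 (x, c) ⟨hx, hc⟩
      simp only [Ctx.n, Ctx.ext] at h0 h1 h2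
      simp only [Polynomial.eval_add, Polynomial.eval_one, Ctx.n]
      omega) hM hloc
    obtain ⟨P', q', hP'⟩ := hi.comp loc (M + 4) (by omega) hloc'
    refine ⟨.seq P (.seq P' (.setCell M (.read (M + 2 + d) (.cell (M + 4))))), q + (q' + 5),
      fun x hx s hs => ((hP x hx s hs).seq (T' := q'.eval (Γ.n x) + 5) ?_).mono (by simp)
        fun _ => id⟩
    rintro s1 ⟨h1, h2⟩
    refine (hP' x hx s1 (hs.congr hM hloc h1)).seq ?_
    rintro s2 ⟨h3, h4⟩
    refine (Runs.setCell fun s3 h5 h6 => ⟨fun a ha => ?_, ?_⟩).mono (by simp [RExpr.cost])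
      fun _ => id
    · rw [h6 a (by omega), h3 a (by omega), h1 a ha]
    · rw [h5]
      simp only [RExpr.eval]
      rw [h4, h3 _ (by omega)]
      exact hout x hx s1 M h2
  have hlt : ∀ x, Γ.Valid x → i x < (be + bi + b0 + b1 + b2 + 1).eval (Γ.n x) := fun x hx => by
    have := hbi x hx
    simp only [Polynomial.eval_add, Polynomial.eval_one]
    omega
  refine ⟨Comp.congr (E := fun x => if (DegSeq.table (e x) (R x) (N x) (i x)).isSome then 1 else 0)
    (key 0 _ (fun x hx s M h => (h _ (hlt x hx)).1) (by omega)) fun x _ => ?_,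
    key 1 _ (fun x hx s M h => (h _ (hlt x hx)).2) (by omega)⟩
  by_cases h : (DegSeq.table (e x) (R x) (N x) (i x)).isSome <;> simp [h]

/-! ### Regions of a graph cut off by a bag -/

/-- Reachability in the graph `h` by a walk whose vertices after the first one avoid the bag `B`. -/
def Conn {K : ℕ} (h : ℕ → ℕ → Prop) (B : Fin K → ℕ) : ℕ → ℕ → Prop :=
  Relation.ReflTransGen fun a b => h a b ∧ ∀ p, B p ≠ b

/-- The existence of a walk of a given length. -/
def ReachIn (r : ℕ → ℕ → Prop) (u : ℕ) : ℕ → ℕ → Prop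
  | 0, v => v = u
  | t + 1, v => ∃ a, ReachIn r u t a ∧ r a v

/-- A vertex at distance `t` comes with `t` vertices at distances `1, …, t`. -/
theorem ReachIn.exists_finset {r : ℕ → ℕ → Prop} {u n : ℕ} (hr : ∀ a b, r a b → b < n) :
    ∀ t v, ReachIn r u t v → (∀ s < t, ¬ ReachIn r u s v) →
      ∃ A : Finset ℕ, A ⊆ Finset.range n ∧ A.card = t ∧ ∀ w ∈ A, ∃ s ≤ t, ReachIn r u s w
  | 0, _, _, _ => ⟨∅, by simp⟩
  | t + 1, v, ⟨a, ha, hav⟩, hv => by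
    obtain ⟨A, hA, hc, hA'⟩ := exists_finset hr t a ha fun s hs h =>
      hv (s + 1) (by omega) ⟨a, h, hav⟩
    have hvA : v ∉ A := fun h => by
      obtain ⟨s, hs, hsv⟩ := hA' v h
      exact hv s (by omega) hsv
    refine ⟨insert v A, ?_, by rw [Finset.card_insert_of_notMem hvA, hc], ?_⟩
    · exact Finset.insert_subset (Finset.mem_range.2 (hr a v hav)) hA
    · intro w hw
      rcases Finset.mem_insert.1 hw with rfl | hw
      · exact ⟨t + 1, le_rfl, a, ha, hav⟩
      · obtain ⟨s, hs, h⟩ := hA' w hw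
        exact ⟨s, by omega, h⟩

theorem ReachIn.of_reflTransGen {r : ℕ → ℕ → Prop} {u v n : ℕ} (hr : ∀ a b, r a b → b < n)
    (h : Relation.ReflTransGen r u v) : ∃ t ≤ n, ReachIn r u t v := by
  classical
  have hex : ∃ t, ReachIn r u t v := by
    induction h with
    | refl => exact ⟨0, rfl⟩
    | tail _ hb ih =>
      obtain ⟨t, ht⟩ := ih
      exact ⟨t + 1, _, ht, hb⟩
  refine ⟨Nat.find hex, ?_, Nat.find_spec hex⟩
  obtain ⟨A, hA, hc, -⟩ := exists_finset hr _ v (Nat.find_spec hex) fun s hs => Nat.find_min hex hs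
  simpa [hc] using Finset.card_le_card hA

theorem exists_round {m t a b : ℕ} (ha : a < m) (hb : b < m) :
    ∃ c, t * m ^ 2 ≤ c ∧ c < (t + 1) * m ^ 2 ∧ c % m = a ∧ c / m % m = b := by
  have hm : 0 < m := by omega
  refine ⟨a + m * (b + m * t), by nlinarith, by nlinarith, ?_, ?_⟩
  · rw [Nat.add_mul_mod_self_left, Nat.mod_eq_of_lt ha]
  · rw [Nat.add_mul_div_left _ _ hm, Nat.div_eq_of_lt ha, zero_add, Nat.add_mul_mod_self_left,
      Nat.mod_eq_of_lt hb]

/-- Reachability is decidable in polynomial time. -/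
theorem CompP.conn {K : ℕ} {B : Fin K → Γ.X → ℕ} (hB : ∀ p, CompN Γ (B p)) {u v : Γ.X → ℕ}
    (hu : CompN Γ u) (hv : CompN Γ v) :
    CompP Γ fun x => Conn (Γ.inst x).Adj (fun p => B p x) (u x) (v x) := by
  -- Table entry `v` says that `v` is reachable. The rule with number `c` is for the pair of the two
  -- last digits of `c` in base `n + 1`; each of the `n + 1` rounds covers all pairs. The base is not
  -- `n`, so that it is positive.
  let m : Γ.X → ℕ := fun x => Γ.n x + 1
  let N : Γ.X → ℕ := fun x => m x * m x ^ 2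
  let R : Γ.X → ℕ → Rule := fun x c =>
    { ok := (Γ.inst x).Adj (c % m x) (c / m x % m x) ∧ ∀ p, B p x ≠ c / m x % m x
      head := c / m x % m x
      fst := c % m x
      snd := c % m x
      weight := 0 }
  have hm : CompN Γ m := CompN.order.add (CompN.const 1)
  have hN : CompN Γ N := hm.mul (hm.pow 2)
  have hm' : CompN (Γ.ext N) fun y => m y.1 := hm.weaken N
  have h1 : CompN (Γ.ext N) fun y => y.2 % m y.1 := hN.last.mod hm' fun _ _ => Nat.succ_pos _
  have h2 : CompN (Γ.ext N) fun y => y.2 / m y.1 % m y.1 :=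
    (hN.last.div hm' fun _ _ => Nat.succ_pos _).mod hm' fun _ _ => Nat.succ_pos _
  refine (Comp.table hu hv hN (R := R) ⟨?_, h2, h1, h1, Comp.const 0⟩).1.congr fun x hx => ?_
  · exact (h1.adj h2).and (CompP.forall_fin fun p => (((hB p).weaken N).eq h2).not)
  rw [Option.isSome_iff_exists]
  constructor
  · intro h
    obtain ⟨t, ht, h⟩ := ReachIn.of_reflTransGen (n := Γ.n x) (fun a b hab => hab.1.2.1) h
    have key : ∀ t w, ReachIn (fun a b => (Γ.inst x).Adj a b ∧ ∀ p, B p x ≠ b) (u x) t w →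
        AtMost (table (u x) (R x) (t * m x ^ 2)) w 0 := by
      intro t
      induction t with
      | zero =>
        rintro w rfl
        exact ⟨0, le_rfl, by simp [table]⟩
      | succ t ih =>
        rintro w ⟨a, ha, haw, hw⟩
        obtain ⟨c, hc, hc', rfl, rfl⟩ := exists_round (m := m x) (t := t) (a := a) (b := w)
          (haw.1.trans (Nat.lt_succ_self _)) (haw.2.1.trans (Nat.lt_succ_self _))
        exact AtMost.table_rule (R := R x) hc hc' ⟨haw, hw⟩ (ih _ ha) (ih _ ha)
    obtain ⟨v', -, h⟩ := (key t _ h).table_mono (c' := N x)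
      (Nat.mul_le_mul_right _ (ht.trans (Nat.le_succ _)))
    exact ⟨v', h⟩
  · rintro ⟨v', h⟩
    refine table_sound (S := fun i _ => Conn (Γ.inst x).Adj (fun p => B p x) (u x) i)
      Relation.ReflTransGen.refl ?_ _ _ _ h
    intro c a b hok ha _
    exact ha.tail hok

section Regions

variable {k : ℕ} {n : ℕ} {h : ℕ → ℕ → Prop} {B : Fin (k + 1) → ℕ}

/-- The component of `u` in the complement of the bag `B` is adjacent to the first vertex of the
bag. Entries of a bag from `n` on are placeholders, and a placeholder in the first position counts
as adjacent to everything. -/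
def Touches (n : ℕ) (h : ℕ → ℕ → Prop) (B : Fin (k + 1) → ℕ) (u : ℕ) : Prop :=
  ∃ v < n, Conn h B u v ∧ (n ≤ B 0 ∨ h v (B 0))

/-- The vertex `j` is the least one of a component that touches the first vertex of the bag. -/
def New (n : ℕ) (h : ℕ → ℕ → Prop) (B : Fin (k + 1) → ℕ) (j : ℕ) : Prop :=
  (∀ p, B p ≠ j) ∧ Touches n h B j ∧ ∀ w < j, ¬ Conn h B j w

open Classical in
/-- The union of those components of the complement of the bag that touch the first vertex of the
bag and contain a vertex below `j`. -/
noncomputable def region (n : ℕ) (h : ℕ → ℕ → Prop) (B : Fin (k + 1) → ℕ) (j : ℕ) : Finset ℕ :=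
  (Finset.range n).filter fun u => (∀ p, B p ≠ u) ∧ Touches n h B u ∧ ∃ w < j, Conn h B u w

/-- The tuple with `r` in the first position and the former first entry in position `i`, the entry
of which is dropped. -/
def child (B : Fin (k + 1) → ℕ) (i : ℕ) (r : ℕ) (p : Fin (k + 1)) : ℕ :=
  if (p : ℕ) = 0 then r else if (p : ℕ) = i then B 0 else B p

/-- The vertices of a bag are pairwise distinct. -/
def Distinct (n : ℕ) (B : Fin (k + 1) → ℕ) : Prop := ∀ p q, B p = B q → B p < n → p = q

theorem CompN.child {B : Fin (k + 1) → Γ.X → ℕ} (hB : ∀ p, CompN Γ (B p)) {i r : Γ.X → ℕ}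
    (hi : CompN Γ i) (hr : CompN Γ r) (p : Fin (k + 1)) :
    CompN Γ fun x => child (fun p => B p x) (i x) (r x) p :=
  CompN.ite ((CompN.const _).eq (CompN.const _)) hr
    (CompN.ite ((CompN.const _).eq hi) (hB 0) (hB p))

theorem CompP.touches {B : Fin (k + 1) → Γ.X → ℕ} (hB : ∀ p, CompN Γ (B p)) {u : Γ.X → ℕ}
    (hu : CompN Γ u) : CompP Γ fun x => Touches (Γ.n x) (Γ.inst x).Adj (fun p => B p x) (u x) := by
  refine CompP.exists_lt CompN.order ?_
  have h0 := CompN.last (Γ := Γ) CompN.order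
  exact (CompP.conn (Γ := Γ.ext Γ.n) (fun p => (hB p).weaken _) (hu.weaken _) h0).and
    (((CompN.order (Γ := Γ)).weaken _ |>.le ((hB 0).weaken _)).or
      (CompN.adj (Γ := Γ.ext Γ.n) h0 ((hB 0).weaken _)))

theorem CompP.new {B : Fin (k + 1) → Γ.X → ℕ} (hB : ∀ p, CompN Γ (B p)) {j : Γ.X → ℕ}
    (hj : CompN Γ j) : CompP Γ fun x => New (Γ.n x) (Γ.inst x).Adj (fun p => B p x) (j x) := by
  refine (CompP.forall_fin fun p => ((hB p).eq hj).not).and ((CompP.touches hB hj).and ?_)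
  exact CompP.forall_lt hj (CompP.conn (Γ := Γ.ext j) (fun p => (hB p).weaken _) (hj.weaken _)
    hj.last).not

/-- The relation `h` is the adjacency relation of a graph on the natural numbers below `n`. -/
structure IsGraph (n : ℕ) (h : ℕ → ℕ → Prop) : Prop where
  symm : ∀ a b, h a b → h b a
  irrefl : ∀ a, ¬ h a a
  lt : ∀ a b, h a b → a < n

theorem Conn.avoids {u v : ℕ} (hu : ∀ p, B p ≠ u) (huv : Conn h B u v) : ∀ p, B p ≠ v := by
  induction huv with
  | refl => exact hu
  | tail _ hb _ => exact hb.2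

theorem Conn.lt (hg : IsGraph n h) {u v : ℕ} (hu : u < n) (huv : Conn h B u v) : v < n := by
  induction huv with
  | refl => exact hu
  | tail _ hb _ => exact hg.lt _ _ (hg.symm _ _ hb.1)

theorem Conn.symm (hg : IsGraph n h) {u v : ℕ} (hu : ∀ p, B p ≠ u) (huv : Conn h B u v) :
    Conn h B v u := by
  induction huv with
  | refl => exact .refl
  | tail hab hb ih => exact .head ⟨hg.symm _ _ hb.1, Conn.avoids hu hab⟩ ih

theorem Touches.of_conn {u v : ℕ} (huv : Conn h B u v) (hv : Touches n h B v) :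
    Touches n h B u := by
  obtain ⟨w, hw, hvw, h0⟩ := hv
  exact ⟨w, hw, huv.trans hvw, h0⟩

theorem mem_region {j u : ℕ} : u ∈ region n h B j ↔
    u < n ∧ (∀ p, B p ≠ u) ∧ Touches n h B u ∧ ∃ w < j, Conn h B u w := by
  simp [region]

theorem region_zero : region n h B 0 = ∅ := by
  ext u
  simp [mem_region]

theorem region_mono {j j' : ℕ} (hj : j ≤ j') : region n h B j ⊆ region n h B j' := by
  intro u hu
  obtain ⟨h1, h2, h3, w, hw, h4⟩ := mem_region.1 hu
  exact mem_region.2 ⟨h1, h2, h3, w, hw.trans_le hj, h4⟩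

theorem region_succ_of_not_new (hg : IsGraph n h) {j : ℕ} (hj : ¬ New n h B j) :
    region n h B (j + 1) = region n h B j := by
  refine subset_antisymm (fun u hu => ?_) (region_mono (Nat.le_succ j))
  obtain ⟨h1, h2, h3, w, hw, h4⟩ := mem_region.1 hu
  refine mem_region.2 ⟨h1, h2, h3, ?_⟩
  rcases Nat.lt_succ_iff_lt_or_eq.1 hw with hw | rfl
  · exact ⟨w, hw, h4⟩
  · by_contra hn
    push Not at hn
    exact hj ⟨h4.avoids h2, h3.of_conn (h4.symm hg h2), fun v hv hwv => hn v hv (h4.trans hwv)⟩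

theorem mem_region_succ_of_new (hg : IsGraph n h) {j : ℕ} (hjn : j < n) (hj : New n h B j) {u : ℕ} :
    u ∈ region n h B (j + 1) ↔ u ∈ region n h B j ∨ Conn h B j u := by
  constructor
  · intro hu
    obtain ⟨h1, h2, h3, w, hw, h4⟩ := mem_region.1 hu
    rcases Nat.lt_succ_iff_lt_or_eq.1 hw with hw | rfl
    · exact .inl (mem_region.2 ⟨h1, h2, h3, w, hw, h4⟩)
    · exact .inr (h4.symm hg h2)
  · rintro (hu | hu)
    · exact region_mono (Nat.le_succ j) hu
    · exact mem_region.2 ⟨hu.lt hg hjn, hu.avoids hj.1, hj.2.1.of_conn (hu.symm hg hj.1), j,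
        Nat.lt_succ_self j, hu.symm hg hj.1⟩

theorem not_conn_of_mem_region {j : ℕ} (hj : New n h B j) {u : ℕ}
    (hu : u ∈ region n h B j) : ¬ Conn h B j u := by
  obtain ⟨h1, h2, h3, w, hw, h4⟩ := mem_region.1 hu
  exact fun hju => hj.2.2 w hw (hju.trans h4)

theorem child_zero (B : Fin (k + 1) → ℕ) (i r : ℕ) : child B i r 0 = r := by simp [child]

theorem child_cases (B : Fin (k + 1) → ℕ) (i r : ℕ) (q : Fin (k + 1)) :
    child B i r q = r ∨ ∃ p, child B i r q = B p := by
  unfold child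
  split_ifs
  exacts [.inl rfl, .inr ⟨_, rfl⟩, .inr ⟨_, rfl⟩]

/-- Away from the dropped position, the entries of a tuple survive in its children, at a position
that depends only on the dropped position. -/
theorem exists_child_eq {i p : Fin (k + 1)} (hp : p ≠ i) :
    ∃ q : Fin (k + 1), ∀ (B : Fin (k + 1) → ℕ) (r : ℕ), child B i r q = B p := by
  by_cases h0 : p = 0
  · subst h0
    refine ⟨i, fun B r => ?_⟩
    rw [child, if_neg fun h => hp (Fin.ext (by simpa using h.symm)), if_pos rfl]
  · refine ⟨p, fun B r => ?_⟩
    rw [child, if_neg (fun h => h0 (Fin.ext (by simpa using h))), if_neg (fun h => hp (Fin.ext h))]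

/-- If the dropped vertex of the bag is not adjacent to the component of `j`, then the region of the
child is this component without the new vertex `r`. -/
theorem mem_region_child (hg : IsGraph n h) {j r u : ℕ} {i : Fin (k + 1)} (hjn : j < n)
    (hj : ∀ p, B p ≠ j) (hr : Conn h B j r) (hi : ∀ v < n, Conn h B j v → ¬ h v (B i)) :
    u ∈ region n h (child B i r) n ↔ Conn h B j u ∧ u ≠ r := by
  have hrn : r < n := hr.lt hg hjn
  have havoid : ∀ v, Conn h B j v → v ≠ r → ∀ p, child B i r p ≠ v := by
    intro v hv hvr p hp
    rcases child_cases B i r p with h' | ⟨q, h'⟩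
    · exact hvr (hp.symm.trans h')
    · exact hv.avoids hj q (h'.symm.trans hp)
  -- An edge leaving the component ends in the bag, but not in the dropped entry, so in the child.
  have hclosed : ∀ a b, Conn h B j a → h a b → (∀ p, child B i r p ≠ b) → Conn h B j b := by
    intro a b ha hab hb
    refine ha.tail ⟨hab, fun p hp => ?_⟩
    by_cases hpi : p = i
    · subst hpi
      exact hi a (ha.lt hg hjn) ha (hp ▸ hab)
    · obtain ⟨q, hq⟩ := exists_child_eq hpi
      exact hb q ((hq B r).trans hp)
  constructor
  · intro hu
    obtain ⟨hun, hu', ⟨v, hv, huv, h0⟩, -⟩ := mem_region.1 hu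
    refine ⟨?_, fun h => hu' 0 ((child_zero B i r).trans h.symm)⟩
    rw [child_zero] at h0
    have hvr : h v r := h0.resolve_left (by omega)
    have hjv : Conn h B j v := hclosed r v hr (hg.symm _ _ hvr) (huv.avoids hu')
    have hvu := huv.symm hg hu'
    clear huv hu hun hu'
    induction hvu with
    | refl => exact hjv
    | tail _ hb ih => exact hclosed _ _ ih hb.1 hb.2
  · rintro ⟨hu, hur⟩
    refine mem_region.2 ⟨hu.lt hg hjn, havoid u hu hur, ?_, u, hu.lt hg hjn, .refl⟩
    have hru : Conn h B u r := (hu.symm hg hj).trans hr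
    -- The last vertex before `r` on a walk from `u` to `r`.
    have : ∃ v, Conn h (child B i r) u v ∧ h v r := by
      induction hru using Relation.ReflTransGen.head_induction_on with
      | refl => exact absurd rfl hur
      | head hab hbr ih =>
        rename_i a b
        by_cases hb : b = r
        · exact ⟨a, .refl, hb ▸ hab.1⟩
        · have hjb : Conn h B j b := hu.tail hab
          obtain ⟨v, hv, hvr⟩ := ih hjb hb
          exact ⟨v, .head ⟨hab.1, havoid b hjb hb⟩ hv, hvr⟩
    obtain ⟨v, hv, hvr⟩ := this
    exact ⟨v, hg.lt _ _ hvr, hv, .inr (by rwa [child_zero])⟩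

end Regions

/-! ### Costs of regions -/

open Classical in
/-- The number of neighbours of `b` in `W`. -/
noncomputable def degIn (G : ℕ → ℕ → Prop) (W : Finset ℕ) (b : ℕ) : ℕ := (W.filter (G b)).card

/-- The part of the objective that belongs to the vertices in `W`. -/
noncomputable def costIn (n : ℕ) (F : ℕ → ℕ → ℤ) (G : ℕ → ℕ → Prop) (W : Finset ℕ) : ℤ :=
  ∑ w ∈ W, F w (degIn G (Finset.range n) w)

open Classical in
/-- The indicator of a proposition. -/
noncomputable def ind (p : Prop) : ℕ := if p then 1 else 0

theorem degIn_congr {G G' : ℕ → ℕ → Prop} {W : Finset ℕ} {b : ℕ} (h : ∀ w ∈ W, G b w ↔ G' b w) :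
    degIn G W b = degIn G' W b := by
  classical
  unfold degIn
  congr 1
  exact Finset.filter_congr h

theorem costIn_congr {n : ℕ} {F : ℕ → ℕ → ℤ} {G G' : ℕ → ℕ → Prop} {W : Finset ℕ}
    (h : ∀ w ∈ W, ∀ v, G w v ↔ G' w v) : costIn n F G W = costIn n F G' W :=
  Finset.sum_congr rfl fun w hw => by rw [degIn_congr fun v _ => h w hw v]

section Regions

variable {k : ℕ} {n : ℕ} {h : ℕ → ℕ → Prop} {B : Fin (k + 1) → ℕ} {F : ℕ → ℕ → ℤ}

/-- The relation `G` is the adjacency relation of a subgraph of `h`. -/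
structure IsSub (h G : ℕ → ℕ → Prop) : Prop where
  symm : ∀ a b, G a b → G b a
  le : ∀ a b, G a b → h a b

/-- The set `W` is composed of `W₁`, the vertex `r` and `W₂`, where `W₁` is separated from the rest
and the neighbourhood of the rest is in the bag without the entry at `i`. -/
structure Split (h : ℕ → ℕ → Prop) (B : Fin (k + 1) → ℕ) (i : Fin (k + 1)) (r : ℕ)
    (W W₁ W₂ : Finset ℕ) : Prop where
  mem : ∀ u, u ∈ W ↔ u ∈ W₁ ∨ u = r ∨ u ∈ W₂
  notMem_left : r ∉ W₁
  notMem_right : r ∉ W₂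
  disjoint : ∀ u ∈ W₁, u ∉ W₂
  bag : ∀ u ∈ W, ∀ p, B p ≠ u
  sep : ∀ w ∈ W₁, ∀ v, h w v → v ≠ r ∧ v ∉ W₂
  drop : ∀ v, v = r ∨ v ∈ W₂ → ¬ h v (B i)
  nbr : ∀ u, u = r ∨ u ∈ W₂ → ∀ v, h u v → v = r ∨ v ∈ W₂ ∨ ∃ p, B p = v

theorem split_region (hg : IsGraph n h) {j r : ℕ} {i : Fin (k + 1)} (hjn : j < n)
    (hj : New n h B j) (hr : Conn h B j r) (hi : ∀ v < n, Conn h B j v → ¬ h v (B i)) :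
    Split h B i r (region n h B (j + 1)) (region n h B j) (region n h (child B i r) n) := by
  have hc : ∀ u, u ∈ region n h (child B i r) n ↔ Conn h B j u ∧ u ≠ r := fun u =>
    mem_region_child hg hjn hj.1 hr hi
  have hc' : ∀ u, u = r ∨ u ∈ region n h (child B i r) n ↔ Conn h B j u := by
    intro u
    rw [hc]
    constructor
    · rintro (rfl | h)
      exacts [hr, h.1]
    · intro h
      by_cases hu : u = r
      exacts [.inl hu, .inr ⟨h, hu⟩]
  refine ⟨fun u => ?_, fun h => ?_, fun h => ?_, fun u h h' => ?_, fun u hu => ?_,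
    fun w hw v hv => ?_, fun v hv => ?_, fun u hu v hv => ?_⟩
  · rw [mem_region_succ_of_new hg hjn hj, hc']
  · exact not_conn_of_mem_region hj h hr
  · exact ((hc r).1 h).2 rfl
  · exact not_conn_of_mem_region hj h ((hc u).1 h').1
  · exact (mem_region.1 hu).2.1
  · rw [← not_or, hc']
    exact fun hjv => not_conn_of_mem_region hj hw
      (hjv.tail ⟨hg.symm _ _ hv, (mem_region.1 hw).2.1⟩)
  · rw [hc'] at hv
    exact hi v (hv.lt hg hjn) hv
  · rw [hc'] at hu
    by_cases hp : ∃ p, B p = v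
    · exact .inr (.inr hp)
    · push Not at hp
      rw [← or_assoc, hc']
      exact .inl (hu.tail ⟨hv, hp⟩)

variable {i : Fin (k + 1)} {r : ℕ} {W W₁ W₂ : Finset ℕ} {G : ℕ → ℕ → Prop}

theorem Split.eq_union (S : Split h B i r W W₁ W₂) : W = W₁ ∪ insert r W₂ := by
  ext u
  rw [S.mem, Finset.mem_union, Finset.mem_insert]

theorem Split.disjoint' (S : Split h B i r W W₁ W₂) : Disjoint W₁ (insert r W₂) := by
  rw [Finset.disjoint_insert_right]
  exact ⟨S.notMem_left, Finset.disjoint_left.2 S.disjoint⟩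

theorem Split.degIn_eq (S : Split h B i r W W₁ W₂) (b : ℕ) :
    degIn G W b = degIn G W₁ b + (degIn G W₂ b + ind (G b r)) := by
  classical
  have h2 : r ∉ W₂.filter (G b) := fun h => S.notMem_right (Finset.mem_filter.1 h).1
  rw [S.eq_union, degIn, degIn, degIn, Finset.filter_union,
    Finset.card_union_of_disjoint (Finset.disjoint_filter_filter S.disjoint'),
    Finset.filter_insert, ind]
  split_ifs
  · rw [Finset.card_insert_of_notMem h2]
  · rfl

/-- The neighbours of `r` are in `W₂` or in the bag. -/
theorem Split.degIn_range (hg : IsGraph n h) (hB : Distinct n B) (S : Split h B i r W W₁ W₂)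
    (hG : IsSub h G) :
    degIn G (Finset.range n) r = degIn G W₂ r + ∑ p, ind (G r (B p)) := by
  classical
  have hlt : ∀ v, G r v → v < n := fun v hv => hg.lt _ _ (hg.symm _ _ (hG.le _ _ hv))
  -- The neighbours in the bag are counted by position, as the entries of the bag are distinct.
  have e1 : (Finset.range n).filter (G r) =
      W₂.filter (G r) ∪ (Finset.univ.filter fun p => G r (B p)).image B := by
    ext v
    simp only [Finset.mem_filter, Finset.mem_range, Finset.mem_union, Finset.mem_image,
      Finset.mem_univ, true_and]
    constructor
    · rintro ⟨-, hv⟩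
      rcases S.nbr r (.inl rfl) v (hG.le _ _ hv) with rfl | h2 | ⟨p, rfl⟩
      · exact absurd (hG.le _ _ hv) (hg.irrefl _)
      · exact .inl ⟨h2, hv⟩
      · exact .inr ⟨p, hv, rfl⟩
    · rintro (⟨-, hv⟩ | ⟨p, hv, rfl⟩)
      · exact ⟨hlt _ hv, hv⟩
      · exact ⟨hlt _ hv, hv⟩
  have e2 : Disjoint (W₂.filter (G r)) ((Finset.univ.filter fun p => G r (B p)).image B) := by
    rw [Finset.disjoint_left]
    intro v hv hv'
    obtain ⟨p, -, rfl⟩ := Finset.mem_image.1 hv'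
    exact S.bag _ ((S.mem _).2 (.inr (.inr (Finset.mem_filter.1 hv).1))) p rfl
  rw [degIn, degIn, e1, Finset.card_union_of_disjoint e2, Finset.card_image_of_injOn,
    Finset.card_filter (fun p => G r (B p))]
  · simp only [ind]
  · intro p hp q _ hpq
    exact hB p q hpq (hlt _ (by simpa using hp))

theorem Split.costIn_eq (hg : IsGraph n h) (hB : Distinct n B) (S : Split h B i r W W₁ W₂)
    (hG : IsSub h G) : costIn n F G W = costIn n F G W₁ + costIn n F G W₂ +
      F r (degIn G W₂ r + ∑ p, ind (G r (B p))) := by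
  rw [← S.degIn_range hg hB hG, S.eq_union, costIn, costIn, costIn, Finset.sum_union S.disjoint',
    Finset.sum_insert S.notMem_right]
  ring

/-- The value `c` is attained on the region of `B` and `j` by a subgraph that gives the vertices of
the bag the numbers `d` of neighbours in this region. -/
def Attained (n : ℕ) (h : ℕ → ℕ → Prop) (F : ℕ → ℕ → ℤ) (B : Fin (k + 1) → ℕ) (j : ℕ)
    (d : Fin (k + 1) → ℕ) (c : ℤ) : Prop :=
  Distinct n B → ∃ G, IsSub h G ∧ (∀ p, B p < n → d p = degIn G (region n h B j) (B p)) ∧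
    c = costIn n F G (region n h B j)

theorem attained_zero : Attained n h F B 0 (fun _ => 0) 0 := fun _ =>
  ⟨fun _ _ => False, ⟨fun _ _ => id, fun _ _ => False.elim⟩, by simp [degIn],
    by simp [region_zero, costIn]⟩

theorem Attained.succ_of_not_new (hg : IsGraph n h) {j : ℕ} {d : Fin (k + 1) → ℕ} {c : ℤ}
    (hj : ¬ New n h B j) (ha : Attained n h F B j d c) : Attained n h F B (j + 1) d c := by
  unfold Attained
  rwa [region_succ_of_not_new hg hj]

theorem Distinct.child (hB : Distinct n B) {i : Fin (k + 1)} {r : ℕ} (hr : ∀ p, B p ≠ r) :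
    Distinct n (child B i r) := by
  intro p q hpq hlt
  unfold DegSeq.child at hpq hlt
  simp only [Fin.val_eq_zero_iff, Fin.val_inj] at hpq hlt
  have e := hB p q
  have e1 := hB p 0
  have e2 := hB 0 q
  have e3 := hr p
  have e4 := hr q
  have e5 := hr 0
  split_ifs at hpq hlt <;> grind

/-- Which edges at `r` are chosen is described by `x`, the numbers of neighbours of `r` and of the
bag in the region of the child by `y₀` and `y`. -/
theorem Attained.succ_of_new (hg : IsGraph n h) {j r y₀ : ℕ} {i : Fin (k + 1)}
    {d x y : Fin (k + 1) → ℕ} {c c' : ℤ} (hjn : j < n)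
    (hj : New n h B j) (hr : Conn h B j r) (hi : ∀ v < n, Conn h B j v → ¬ h v (B i))
    (hx : ∀ p, x p = 0 ∨ x p = 1 ∧ h r (B p)) (hyi : y i = 0)
    (ha : Attained n h F B j d c)
    (ha' : Attained n h F (child B i r) n (child y i y₀) c') :
    Attained n h F B (j + 1) (fun p => d p + (y p + x p)) (c + c' + F r (y₀ + ∑ p, x p)) := by
  classical
  intro hB
  have S := split_region hg hjn hj hr hi
  have hrn : r < n := hr.lt hg hjn
  have hrB := hr.avoids hj.1
  obtain ⟨G₁, hG₁, hd₁, rfl⟩ := ha hB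
  obtain ⟨G₂, hG₂, hd₂, rfl⟩ := ha' (hB.child hrB)
  have hy0 : y₀ = degIn G₂ (region n h (DegSeq.child B i r) n) r := by
    have := hd₂ 0
    rw [child_zero, child_zero] at this
    exact this hrn
  have hy : ∀ p, p ≠ i → B p < n → y p = degIn G₂ (region n h (DegSeq.child B i r) n) (B p) := by
    intro p hp hpn
    obtain ⟨q, hq⟩ := exists_child_eq hp
    have := hd₂ q
    rw [hq, hq] at this
    exact this hpn
  generalize region n h (DegSeq.child B i r) n = W₂ at *
  generalize region n h B j = W₁ at *
  generalize region n h B (j + 1) = W at *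
  have bag₁ : ∀ w ∈ W₁, ∀ p, B p ≠ w := fun w hw => S.bag w ((S.mem w).2 (.inl hw))
  have bag₂ : ∀ w ∈ W₂, ∀ p, B p ≠ w := fun w hw => S.bag w ((S.mem w).2 (.inr (.inr hw)))
  -- The three parts are glued along the bag.
  let G : ℕ → ℕ → Prop := fun u v => (G₁ u v ∧ (u ∈ W₁ ∨ v ∈ W₁)) ∨ (G₂ u v ∧ (u ∈ W₂ ∨ v ∈ W₂)) ∨
    ∃ p, x p = 1 ∧ (u = r ∧ v = B p ∨ v = r ∧ u = B p)
  have hxh : ∀ p, x p = 1 → h r (B p) := fun p hp => by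
    rcases hx p with h0 | h1
    · omega
    · exact h1.2
  have hG : IsSub h G := by
    constructor
    · rintro a b (⟨h1, h2⟩ | ⟨h1, h2⟩ | ⟨p, h1, h2⟩)
      · exact .inl ⟨hG₁.symm _ _ h1, h2.symm⟩
      · exact .inr (.inl ⟨hG₂.symm _ _ h1, h2.symm⟩)
      · exact .inr (.inr ⟨p, h1, h2.symm⟩)
    · rintro a b (⟨h1, h2⟩ | ⟨h1, h2⟩ | ⟨p, h1, ⟨rfl, rfl⟩ | ⟨rfl, rfl⟩⟩)
      · exact hG₁.le _ _ h1
      · exact hG₂.le _ _ h1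
      · exact hxh p h1
      · exact hg.symm _ _ (hxh p h1)
  have g1 : ∀ w ∈ W₁, ∀ v, G w v ↔ G₁ w v := by
    intro w hw v
    constructor
    · rintro (⟨h1, -⟩ | ⟨h1, h2⟩ | ⟨p, h1, ⟨rfl, -⟩ | ⟨-, rfl⟩⟩)
      · exact h1
      · exact absurd h2 (not_or.2 ⟨S.disjoint w hw, (S.sep w hw v (hG₂.le _ _ h1)).2⟩)
      · exact absurd hw S.notMem_left
      · exact absurd rfl (bag₁ _ hw p)
    · exact fun h1 => .inl ⟨h1, .inl hw⟩
  have g2 : ∀ w ∈ W₂, ∀ v, G w v ↔ G₂ w v := by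
    intro w hw v
    constructor
    · rintro (⟨h1, h2 | h2⟩ | ⟨h1, -⟩ | ⟨p, h1, ⟨rfl, -⟩ | ⟨-, rfl⟩⟩)
      · exact absurd hw (S.disjoint w h2)
      · exact absurd hw (S.sep v h2 w (hg.symm _ _ (hG₁.le _ _ h1))).2
      · exact h1
      · exact absurd hw S.notMem_right
      · exact absurd rfl (bag₂ _ hw p)
    · exact fun h1 => .inr (.inl ⟨h1, .inl hw⟩)
  have g1' : ∀ b, degIn G W₁ b = degIn G₁ W₁ b := fun b => degIn_congr fun w hw =>
    ⟨fun h' => hG₁.symm _ _ ((g1 w hw b).1 (hG.symm _ _ h')),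
      fun h' => hG.symm _ _ ((g1 w hw b).2 (hG₁.symm _ _ h'))⟩
  have g2' : ∀ b, degIn G W₂ b = degIn G₂ W₂ b := fun b => degIn_congr fun w hw =>
    ⟨fun h' => hG₂.symm _ _ ((g2 w hw b).1 (hG.symm _ _ h')),
      fun h' => hG.symm _ _ ((g2 w hw b).2 (hG₂.symm _ _ h'))⟩
  have gx : ∀ p, ind (G r (B p)) = x p := by
    intro p
    have : G r (B p) ↔ x p = 1 := by
      constructor
      · rintro (⟨-, h2⟩ | ⟨-, h2⟩ | ⟨q, h1, ⟨-, h2⟩ | ⟨h2, -⟩⟩)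
        · exact absurd h2 (not_or.2 ⟨S.notMem_left, fun h' => bag₁ _ h' p rfl⟩)
        · exact absurd h2 (not_or.2 ⟨S.notMem_right, fun h' => bag₂ _ h' p rfl⟩)
        · have hlt : B p < n := h2 ▸ hg.lt _ _ (hg.symm _ _ (hxh q h1))
          exact hB p q h2 hlt ▸ h1
        · exact absurd h2 (hrB p)
      · exact fun h1 => .inr (.inr ⟨p, h1, .inl ⟨rfl, rfl⟩⟩)
    unfold ind
    rcases hx p with h0 | h1
    · rw [if_neg (by rw [this]; omega), h0]
    · rw [if_pos (this.2 h1.1), h1.1]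
  refine ⟨G, hG, fun p hp => ?_, ?_⟩
  · have hs : ind (G (B p) r) = x p := by
      rw [← gx p]
      congr 1
      exact propext ⟨hG.symm _ _, hG.symm _ _⟩
    beta_reduce
    rw [S.degIn_eq, g1', g2', hs, ← hd₁ p hp]
    by_cases hpi : p = i
    · subst hpi
      have : degIn G₂ W₂ (B p) = 0 := by
        rw [degIn, Finset.card_eq_zero, Finset.filter_eq_empty_iff]
        exact fun v hv hv' => S.drop v (.inr hv) (hg.symm _ _ (hG₂.le _ _ hv'))
      rw [this, hyi]
    · rw [hy p hpi hp]
  · rw [S.costIn_eq hg hB hG, costIn_congr g1, costIn_congr g2, g2', ← hy0]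
    simp only [gx]

end Regions

section Regions

variable {k : ℕ} {n : ℕ} {h : ℕ → ℕ → Prop} {B : Fin (k + 1) → ℕ} {F : ℕ → ℕ → ℤ}

/-! ### Derivations along an elimination order -/

/-- The numbering `rank` of the vertices is an elimination order of width `k`: at most `k` vertices
after `r` are adjacent to a vertex that is reachable from `r` through vertices up to `r`. -/
structure IsElimination (n k : ℕ) (h : ℕ → ℕ → Prop) (rank : ℕ → ℕ) : Prop where
  inj : ∀ a < n, ∀ b < n, rank a = rank b → a = b
  card_le : ∀ r < n, ∃ S : Finset ℕ, S.card ≤ k ∧ ∀ y x,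
    Relation.ReflTransGen (fun a b => h a b ∧ rank b ≤ rank r) r y → h y x → rank r < rank x → x ∈ S

/-- The vertices of the region precede the vertices of the bag that their components are adjacent
to. -/
def Precedes (n : ℕ) (h : ℕ → ℕ → Prop) (rank : ℕ → ℕ) (B : Fin (k + 1) → ℕ) : Prop :=
  ∀ u ∈ region n h B n, ∀ v, Conn h B u v → ∀ p, h v (B p) → rank u < rank (B p)

theorem degIn_region_le {G : ℕ → ℕ → Prop} {j b : ℕ} : degIn G (region n h B j) b ≤ n := by
  classical
  calc _ ≤ (region n h B j).card := Finset.card_filter_le _ _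
    _ ≤ (Finset.range n).card := Finset.card_le_card fun u hu => by
      simpa using (mem_region.1 hu).1
    _ = n := Finset.card_range n

/-- In each component there is a vertex `r`, the last one in the order, and a position `i` of the
bag such that the child is again of the same kind. -/
theorem exists_child (hg : IsGraph n h) {rank : ℕ → ℕ} (hrank : IsElimination n k h rank)
    (hB : Distinct n B) (hP : Precedes n h rank B) {j : ℕ} (hjn : j < n) (hj : New n h B j) :
    ∃ (r : ℕ) (i : Fin (k + 1)), Conn h B j r ∧ (∀ v < n, Conn h B j v → ¬ h v (B i)) ∧
      Precedes n h rank (child B i r) := by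
  classical
  obtain ⟨r, hr, hmax⟩ := ((Finset.range n).filter (Conn h B j)).exists_max_image rank
    ⟨j, Finset.mem_filter.2 ⟨Finset.mem_range.2 hjn, .refl⟩⟩
  replace hr : Conn h B j r := (Finset.mem_filter.1 hr).2
  replace hmax : ∀ v, Conn h B j v → rank v ≤ rank r := fun v hv =>
    hmax v (Finset.mem_filter.2 ⟨Finset.mem_range.2 (hv.lt hg hjn), hv⟩)
  have hreg : ∀ v, Conn h B j v → v ∈ region n h B n := fun v hv =>
    region_mono (by omega) ((mem_region_succ_of_new hg hjn hj).2 (.inr hv))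
  have hrn : r < n := hr.lt hg hjn
  -- Otherwise the `k + 1` entries of the bag would be distinct later vertices reached from `r`.
  obtain ⟨i, hi⟩ : ∃ i, ∀ v < n, Conn h B j v → ¬ h v (B i) := by
    by_contra! hcon
    obtain ⟨S, hS, hS'⟩ := hrank.card_le r hrn
    have hBS : ∀ p, B p ∈ S ∧ B p < n := by
      intro p
      obtain ⟨v, hv, hjv, hvp⟩ := hcon p
      have hrv : Conn h B r v := (hr.symm hg hj.1).trans hjv
      refine ⟨hS' v (B p) ?_ hvp (hP r (hreg r hr) v hrv p hvp), hg.lt _ _ (hg.symm _ _ hvp)⟩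
      clear hvp hjv
      induction hrv with
      | refl => exact .refl
      | tail hab hb ih =>
        exact (ih (hg.lt _ _ hb.1)).tail ⟨hb.1, hmax _ (hr.trans (hab.tail hb))⟩
    have := Finset.card_le_card_of_injOn (s := Finset.univ) (t := S) B (fun p _ => (hBS p).1)
      fun p _ q _ hpq => hB p q hpq (hBS p).2
    simp only [Finset.card_univ, Fintype.card_fin] at this
    omega
  refine ⟨r, i, hr, hi, fun u hu v huv p hvp => ?_⟩
  have hju := (mem_region_child hg hjn hj.1 hr hi).1 hu
  have hu' := mem_region.1 hu
  have hv : v ∈ region n h (child B i r) n := mem_region.2 ⟨huv.lt hg hu'.1, huv.avoids hu'.2.1,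
    hu'.2.2.1.of_conn (huv.symm hg hu'.2.1), v, huv.lt hg hu'.1, .refl⟩
  have hjv := (mem_region_child hg hjn hj.1 hr hi).1 hv
  rcases child_cases B i r p with h' | ⟨q, h'⟩
  · rw [h']
    exact lt_of_le_of_ne (hmax u hju.1) fun h => hju.2 (hrank.inj _ hu'.1 _ hrn h)
  · rw [h'] at hvp ⊢
    exact hP u (hreg u hju.1) v ((hju.1.symm hg hj.1).trans hjv.1) q hvp

/-- The values of a subgraph on all regions of bags that agree with an elimination order are
derivable, in a number of rounds that is bounded in terms of the size of the region. -/
theorem derivable_of_isElimination (hg : IsGraph n h) {rank : ℕ → ℕ}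
    (hrank : IsElimination n k h rank)
    (D : ℕ → (Fin (k + 1) → ℕ) → ℕ → (Fin (k + 1) → ℕ) → ℤ → Prop)
    (Dmono : ∀ t t' B j d c, t ≤ t' → D t B j d c → D t' B j d c)
    (Dzero : ∀ t B, (∀ p, B p ≤ n) → D (t + 1) B 0 (fun _ => 0) 0)
    (Dold : ∀ t B j d c, (∀ p, B p ≤ n) → (∀ p, d p ≤ n) → j < n → ¬ New n h B j →
      D t B j d c → D (t + 1) B (j + 1) d c)
    (Dnew : ∀ t B j r y₀ (i : Fin (k + 1)) (d x y : Fin (k + 1) → ℕ) c c', (∀ p, B p ≤ n) → (∀ p, d p ≤ n) →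
      (∀ p, y p ≤ n) → y₀ ≤ n → j < n → New n h B j → Conn h B j r →
      (∀ v < n, Conn h B j v → ¬ h v (B i)) → (∀ p, x p = 0 ∨ x p = 1 ∧ h r (B p)) → y i = 0 →
      D t B j d c → D t (child B i r) n (child y i y₀) c' →
      D (t + 1) B (j + 1) (fun p => d p + (y p + x p)) (c + c' + F r (y₀ + ∑ p, x p)))
    {G : ℕ → ℕ → Prop} (hG : IsSub h G) :
    ∀ m (B : Fin (k + 1) → ℕ), (∀ p, B p ≤ n) → Distinct n B → Precedes n h rank B →
      (region n h B n).card ≤ m → ∀ j ≤ n, D ((n + 1) * m + j + 1) B j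
        (fun p => degIn G (region n h B j) (B p)) (costIn n F G (region n h B j)) := by
  classical
  intro m
  induction m using Nat.strong_induction_on with
  | _ m ihm =>
  intro B hBn hB hP hm j
  induction j with
  | zero =>
    intro _
    have := Dzero ((n + 1) * m) B hBn
    simpa [region_zero, degIn, costIn] using this
  | succ j ihj =>
    intro hjn
    have ih := ihj (by omega)
    by_cases hj : New n h B j
    · obtain ⟨r, i, hr, hi, hP'⟩ := exists_child hg hrank hB hP hjn hj
      have S := split_region hg hjn hj hr hi
      have hlt : (region n h (child B i r) n).card < m := by
        refine lt_of_lt_of_le (Finset.card_lt_card ?_) hm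
        have hsub := region_mono (n := n) (h := h) (B := B) hjn
        refine (Finset.ssubset_iff_of_subset fun u hu => hsub ((S.mem u).2 (.inr (.inr hu)))).2
          ⟨r, hsub ((S.mem r).2 (.inr (.inl rfl))), S.notMem_right⟩
      have hc := ihm (m - 1) (by omega) (child B i r) (fun p => by
          rcases child_cases B i r p with h' | ⟨q, h'⟩
          · exact h'.trans_le (hr.lt hg hjn).le
          · exact h'.trans_le (hBn q)) (hB.child (hr.avoids hj.1)) hP' (by omega) n le_rfl
      -- The region of the child is smaller, which leaves `n + 1` rounds for passing from `0` to `n`.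
      have hc' := Dmono _ ((n + 1) * m + j + 1) _ _ _ _ (by
        obtain ⟨m', rfl⟩ : ∃ m', m = m' + 1 := ⟨m - 1, by omega⟩
        simp only [Nat.add_sub_cancel, Nat.mul_add]
        omega) hc
      have hnot : ∀ v, v = r ∨ v ∈ region n h (child B i r) n → ¬ G (B i) v := fun v hv hv' =>
        S.drop v hv (hg.symm _ _ (hG.le _ _ hv'))
      have hind : ∀ p, ind (G (B p) r) = ind (G r (B p)) := fun p => by
        congr 1
        exact propext ⟨hG.symm _ _, hG.symm _ _⟩
      have hd : (fun q => degIn G (region n h (child B i r) n) (child B i r q)) =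
          child (fun p => degIn G (region n h (child B i r) n) (B p)) i
            (degIn G (region n h (child B i r) n) r) := by
        funext q
        conv_rhs => rw [child]
        conv_lhs => arg 3; rw [child]
        split_ifs <;> rfl
      rw [hd] at hc'
      have key := Dnew _ B j r _ i _ (fun p => ind (G r (B p))) _ _ _ hBn
        (fun p => degIn_region_le) (fun p => degIn_region_le) degIn_region_le hjn hj hr hi
        (fun p => ?_) ?_ ih hc'
      · rw [S.costIn_eq hg hB hG]
        simp only [S.degIn_eq, hind]
        exact key
      · by_cases h' : G r (B p)
        · exact .inr ⟨if_pos h', hG.le _ _ h'⟩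
        · exact .inl (if_neg h')
      · rw [degIn, Finset.card_eq_zero, Finset.filter_eq_empty_iff]
        exact fun v hv => hnot v (.inr hv)
    · rw [region_succ_of_not_new hg hj]
      exact Dold _ B j _ _ hBn (fun p => degIn_region_le) hjn hj ih

end Regions

/-! ### Elimination orders from tree decompositions -/

section Tree

variable {N : ℕ} {T : SimpleGraph (Fin N)}

/-- The node `p` lies on every walk from the root `ρ` to the node `t`. -/
def IsAncestor (T : SimpleGraph (Fin N)) (ρ p t : Fin N) : Prop :=
  ∀ w : T.Walk ρ t, p ∈ w.support

/-- The only edge that leaves the set of descendants of `p` leads from `p` towards the root. -/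
theorem IsAncestor.eq_and_dist_lt (hT : T.IsTree) {ρ p a b : Fin N} (ha : IsAncestor T ρ p a)
    (hb : ¬ IsAncestor T ρ p b) (hab : T.Adj a b) : a = p ∧ T.dist ρ b < T.dist ρ p := by
  classical
  simp only [IsAncestor, not_forall] at hb
  obtain ⟨w, hw⟩ := hb
  have hw' : p ∉ w.bypass.support := fun h => hw (w.support_bypass_subset_support h)
  have hpa : p = a := by
    have := ha (w.concat hab.symm)
    rw [SimpleGraph.Walk.support_concat, List.mem_append] at this
    simpa using this.resolve_left hw
  subst hpa
  refine ⟨rfl, ?_⟩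
  have hpath : (w.bypass.concat hab.symm).IsPath := w.bypass_isPath.concat hw' hab.symm
  obtain ⟨q, hq, h1⟩ := hT.connected.exists_path_of_dist ρ p
  have h2 := SimpleGraph.dist_le w.bypass
  rw [(hT.existsUnique_path ρ p).unique hq hpath, SimpleGraph.Walk.length_concat] at h1
  omega

theorem IsAncestor.exists_of_walk (hT : T.IsTree) {ρ p s t : Fin N} (q : T.Walk s t)
    (hs : IsAncestor T ρ p s) (ht : ¬ IsAncestor T ρ p t) :
    p ∈ q.support ∧ ∃ b ∈ q.support, T.dist ρ b < T.dist ρ p := by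
  induction q with
  | nil => exact absurd hs ht
  | @cons s s' t hss' q ih =>
    by_cases hs' : IsAncestor T ρ p s'
    · obtain ⟨h1, b, hb, h2⟩ := ih hs' ht
      exact ⟨List.mem_cons_of_mem _ h1, b, List.mem_cons_of_mem _ hb, h2⟩
    · obtain ⟨rfl, h2⟩ := hs.eq_and_dist_lt hT hs' hss'
      exact ⟨SimpleGraph.Walk.start_mem_support _, s',
        List.mem_cons_of_mem _ q.start_mem_support, h2⟩

theorem IsAncestor.eq_of_dist_le (hT : T.IsTree) {ρ p t : Fin N} (h : IsAncestor T ρ p t)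
    (hd : T.dist ρ t ≤ T.dist ρ p) : p = t := by
  classical
  obtain ⟨w, hw⟩ := hT.connected.exists_walk_length_eq_dist ρ t
  have h1 := congrArg SimpleGraph.Walk.length (w.take_spec (h w))
  rw [SimpleGraph.Walk.length_append] at h1
  have h2 := SimpleGraph.dist_le (w.takeUntil p (h w))
  exact SimpleGraph.Walk.eq_of_length_eq_zero (p := w.dropUntil p (h w)) (by omega)

end Tree

theorem exists_isElimination {n k : ℕ} {H : SimpleGraph (Fin n)} (hH : treewidth H ≤ (k : ℕ∞))
    {h : ℕ → ℕ → Prop} (hh : ∀ a b, h a b ↔ ∃ (ha : a < n) (hb : b < n), H.Adj ⟨a, ha⟩ ⟨b, hb⟩) :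
    ∃ rank, IsElimination n k h rank := by
  classical
  obtain ⟨D, hD⟩ : ∃ D : TreeDecomposition H, D.width ≤ k := by
    by_contra! hcon
    have : ((k + 1 : ℕ) : ℕ∞) ≤ treewidth H := le_iInf fun D => by exact_mod_cast hcon D
    have := this.trans hH
    norm_cast at this
    omega
  have hcard : ∀ t, (D.bag t).card ≤ k + 1 := fun t => by
    have : (D.bag t).card ≤ Finset.univ.sup fun v => (D.bag v).card :=
      Finset.le_sup (f := fun v => (D.bag v).card) (Finset.mem_univ t)
    have h2 := hD
    unfold TreeDecomposition.width at h2
    omega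
  obtain ⟨ρ⟩ := D.isTree.connected.nonempty
  -- A vertex comes the later in the order, the closer its bags come to the root.
  have htop : ∀ v : Fin n, ∃ t, v ∈ D.bag t ∧ ∀ t', v ∈ D.bag t' →
      D.tree.dist ρ t ≤ D.tree.dist ρ t' := fun v => by
    obtain ⟨t₀, ht₀⟩ := D.vertex_mem v
    obtain ⟨t, ht, hmin⟩ := (Finset.univ.filter fun t => v ∈ D.bag t).exists_min_image
      (D.tree.dist ρ) ⟨t₀, by simpa using ht₀⟩
    exact ⟨t, by simpa using ht, fun t' ht' => hmin t' (by simpa using ht')⟩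
  choose top htop hmin using htop
  let depth : ℕ → ℕ := fun v => if hv : v < n then D.tree.dist ρ (top ⟨v, hv⟩) else 0
  have hdepth : ∀ v (hv : v < n), depth v = D.tree.dist ρ (top ⟨v, hv⟩) := fun v hv => dif_pos hv
  let M := ∑ v ∈ Finset.range n, depth v
  have hM : ∀ v < n, depth v ≤ M := fun v hv =>
    Finset.single_le_sum (f := depth) (fun _ _ => Nat.zero_le _) (Finset.mem_range.2 hv)
  -- Ties in depth are broken by the number of the vertex.
  let rank : ℕ → ℕ := fun v => (M - depth v) * n + v
  have hrank : ∀ a < n, ∀ b < n, rank a ≤ rank b → depth b ≤ depth a := by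
    intro a ha b hb hab
    have ha' := hM a ha
    have hb' := hM b hb
    by_contra! hlt
    have : (M - depth b + 1) * n ≤ (M - depth a) * n := Nat.mul_le_mul_right _ (by omega)
    simp only [rank] at hab
    rw [Nat.add_mul] at this
    omega
  refine ⟨rank, fun a ha b hb hab => ?_, fun r hr => ?_⟩
  · have := congrArg (· % n) hab
    simpa [rank, Nat.mul_add_mod_of_lt ha, Nat.mul_add_mod_of_lt hb] using this
  let p := top ⟨r, hr⟩
  have hpath : ∀ s t, ∃ q : D.tree.Walk s t, q.IsPath := fun s t =>
    ⟨_, (D.isTree.connected s t).some.bypass_isPath⟩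
  -- If no bag of `v` is closer to the root than `p`, then the bags of `v` do not leave the set of
  -- descendants of `p`.
  have hdesc : ∀ v : Fin n, D.tree.dist ρ p ≤ D.tree.dist ρ (top v) → ∀ s t, v ∈ D.bag s →
      v ∈ D.bag t → IsAncestor D.tree ρ p s → IsAncestor D.tree ρ p t := by
    intro v hv s t hs ht hps
    by_contra hpt
    obtain ⟨q, hq⟩ := hpath s t
    obtain ⟨-, b, hb, hlt⟩ := hps.exists_of_walk D.isTree q hpt
    have := hmin v b (D.path_mem s t q hq b hb v hs ht)
    omega
  refine ⟨((D.bag p).erase ⟨r, hr⟩).map Fin.valEmbedding, ?_, fun y x hy hyx hrx => ?_⟩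
  · rw [Finset.card_map, Finset.card_erase_of_mem (htop _)]
    exact Nat.sub_le_of_le_add (hcard p)
  have key : ∃ hy : y < n, ∀ t, ⟨y, hy⟩ ∈ D.bag t → IsAncestor D.tree ρ p t := by
    clear hyx
    induction hy with
    | refl => exact ⟨hr, fun t ht => hdesc _ le_rfl p t (htop _) ht fun w => w.end_mem_support⟩
    | tail _ hb ih =>
      obtain ⟨ha, ih⟩ := ih
      obtain ⟨_, hbn, hadj⟩ := (hh _ _).1 hb.1
      obtain ⟨s, hs, hs'⟩ := D.edge_mem _ _ hadj
      have := hrank _ hbn _ hr hb.2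
      rw [hdepth _ hbn, hdepth _ hr] at this
      exact ⟨hbn, fun t ht => hdesc _ this s t hs' ht (ih s hs)⟩
  obtain ⟨hyn, key⟩ := key
  obtain ⟨_, hxn, hadj⟩ := (hh _ _).1 hyx
  obtain ⟨s, hs, hs'⟩ := D.edge_mem _ _ hadj
  have hle := hrank _ hr _ hxn hrx.le
  rw [hdepth _ hxn, hdepth _ hr] at hle
  have hxp : (⟨x, hxn⟩ : Fin n) ∈ D.bag p := by
    by_cases hpt : IsAncestor D.tree ρ p (top ⟨x, hxn⟩)
    · rw [hpt.eq_of_dist_le D.isTree hle]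
      exact htop _
    · obtain ⟨q, hq⟩ := hpath s (top ⟨x, hxn⟩)
      obtain ⟨hp, -⟩ := (key s hs).exists_of_walk D.isTree q hpt
      exact D.path_mem _ _ q hq p hp _ hs' (htop _)
  refine Finset.mem_map.2 ⟨⟨x, hxn⟩, Finset.mem_erase.2 ⟨fun h => ?_, hxp⟩, rfl⟩
  have : x = r := congrArg Fin.val h
  subst this
  exact lt_irrefl _ hrx

variable {k : ℕ}

/-! ### The rules of the dynamic program -/

/-- An injective encoding of tuples by natural numbers. -/
def code : ∀ {K : ℕ}, (Fin K → ℕ) → ℕ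
  | 0, _ => 0
  | _ + 1, t => Nat.pair (t 0) (code fun p => t p.succ)

theorem code_injective : ∀ {K : ℕ}, Function.Injective (code (K := K))
  | 0, _, _, _ => Subsingleton.elim _ _
  | _ + 1, t, t', h => by
    obtain ⟨h0, h1⟩ := Nat.pair_eq_pair.1 h
    funext p
    exact Fin.cases h0 (fun p => congrFun (code_injective h1) p) p

theorem CompN.code : ∀ {K : ℕ} {t : Fin K → Γ.X → ℕ}, (∀ p, CompN Γ (t p)) →
    CompN Γ fun x => code fun p => t p x
  | 0, _, _ => CompN.const 0
  | _ + 1, _, h => (h 0).pair (CompN.code fun p => h p.succ)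

/-- The index of the state consisting of the region of `B` and `j` and the numbers `d` of neighbours
in this region. The index `0` is left for the initial entry of the table. -/
def stateCode (B : Fin (k + 1) → ℕ) (j : ℕ) (d : Fin (k + 1) → ℕ) : ℕ :=
  Nat.pair (code B) (Nat.pair j (code d)) + 1

theorem stateCode_inj {B B' d d' : Fin (k + 1) → ℕ} {j j' : ℕ}
    (h : stateCode B j d = stateCode B' j' d') : B = B' ∧ j = j' ∧ d = d' := by
  obtain ⟨h1, h2⟩ := Nat.pair_eq_pair.1 (Nat.succ_injective h)
  obtain ⟨h3, h4⟩ := Nat.pair_eq_pair.1 h2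
  exact ⟨code_injective h1, h3, code_injective h4⟩

theorem CompN.stateCode {B d : Fin (k + 1) → Γ.X → ℕ} {j : Γ.X → ℕ} (hB : ∀ p, CompN Γ (B p))
    (hj : CompN Γ j) (hd : ∀ p, CompN Γ (d p)) :
    CompN Γ fun x => stateCode (fun p => B p x) (j x) (fun p => d p x) :=
  ((CompN.code hB).pair (hj.pair (CompN.code hd))).add (CompN.const 1)

/-- The parameters of a rule. With `kind = 0` it is the rule for an empty region. Otherwise it leads
from the region of `B` and `j` to that of `B` and `j + 1`, where `d`, `y` and `x` count the
neighbours of the bag in the former region, in the region of the child and in `{r}`, and `y₀` the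
neighbours of `r` in the region of the child. -/
structure Param (k : ℕ) where
  kind : ℕ
  j : ℕ
  i : ℕ
  r : ℕ
  y₀ : ℕ
  B : Fin (k + 1) → ℕ
  d : Fin (k + 1) → ℕ
  y : Fin (k + 1) → ℕ
  x : Fin (k + 1) → ℕ

/-- The conditions on the parameters of a rule for a new component. -/
def Param.Joins (a : Param k) (I : Inst) : Prop :=
  Conn I.Adj a.B a.j a.r ∧
    (∃ p : Fin (k + 1), (p : ℕ) = a.i ∧ a.y p = 0 ∧
      ∀ v < I.n, Conn I.Adj a.B a.j v → ¬ I.Adj v (a.B p)) ∧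
    ∀ p, a.x p = 0 ∨ a.x p = 1 ∧ I.Adj a.r (a.B p)

open Classical in
/-- The rule with given parameters. -/
noncomputable def Param.rule (a : Param k) (I : Inst) : Rule where
  ok := a.kind = 0 ∨ a.j < I.n ∧ (New I.n I.Adj a.B a.j → a.Joins I) ∧
    (¬ New I.n I.Adj a.B a.j → ∀ p, a.y p = 0 ∧ a.x p = 0)
  head := if a.kind = 0 then stateCode a.B 0 fun _ => 0
    else stateCode a.B (a.j + 1) fun p => a.d p + (a.y p + a.x p)
  fst := if a.kind = 0 then 0 else stateCode a.B a.j a.d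
  snd := if a.kind = 0 then 0 else if New I.n I.Adj a.B a.j then
    stateCode (child a.B a.i a.r) I.n (child a.y a.i a.y₀) else 0
  weight := if a.kind = 0 then 0 else if New I.n I.Adj a.B a.j then
    I.val a.r (a.y₀ + ∑ p, a.x p) else 0

/-- The parameters with number `c`, which are its digits in base `m`. -/
def Param.decode (k m c : ℕ) : Param k where
  kind := c / m ^ 0 % m
  j := c / m ^ 1 % m
  i := c / m ^ 2 % m
  r := c / m ^ 3 % m
  y₀ := c / m ^ 4 % m
  B p := c / m ^ (4 * (p : ℕ) + 5) % m
  d p := c / m ^ (4 * (p : ℕ) + 6) % m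
  y p := c / m ^ (4 * (p : ℕ) + 7) % m
  x p := c / m ^ (4 * (p : ℕ) + 8) % m

theorem compRule_decode {m c : Γ.X → ℕ} (hm : CompN Γ m) (hpos : ∀ x, Γ.Valid x → 0 < m x)
    (hc : CompN Γ c) : CompRule Γ fun x => (Param.decode k (m x) (c x)).rule (Γ.inst x) := by
  classical
  have dig : ∀ q, CompN Γ fun x => c x / m x ^ q % m x := fun q =>
    (hc.div (hm.pow q) fun x hx => Nat.pow_pos (hpos x hx)).mod hm hpos
  have hB : ∀ p : Fin (k + 1), CompN Γ fun x => (Param.decode k (m x) (c x)).B p := fun p => dig _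
  have hd : ∀ p : Fin (k + 1), CompN Γ fun x => (Param.decode k (m x) (c x)).d p := fun p => dig _
  have hy : ∀ p : Fin (k + 1), CompN Γ fun x => (Param.decode k (m x) (c x)).y p := fun p => dig _
  have hx : ∀ p : Fin (k + 1), CompN Γ fun x => (Param.decode k (m x) (c x)).x p := fun p => dig _
  have hkind : CompN Γ fun x => (Param.decode k (m x) (c x)).kind := dig 0
  have hj : CompN Γ fun x => (Param.decode k (m x) (c x)).j := dig 1
  have hi : CompN Γ fun x => (Param.decode k (m x) (c x)).i := dig 2
  have hr : CompN Γ fun x => (Param.decode k (m x) (c x)).r := dig 3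
  have hy₀ : CompN Γ fun x => (Param.decode k (m x) (c x)).y₀ := dig 4
  generalize (fun x => Param.decode k (m x) (c x)) = a at *
  have h0 := hkind.eq (CompN.const 0)
  have hnew := CompP.new hB hj
  have hjoins : CompP Γ fun x => (Param.decode k (m x) (c x)).Joins (Γ.inst x) := by
    refine (CompP.conn hB hj hr).and ((CompP.exists_fin fun p => ((CompN.const _).eq hi).and
      (((hy p).eq (CompN.const 0)).and ?_)).and (CompP.forall_fin fun p =>
        ((hx p).eq (CompN.const 0)).or (((hx p).eq (CompN.const 1)).and (hr.adj (hB p)))))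
    have hl := CompN.last (Γ := Γ) CompN.order
    exact CompP.forall_lt CompN.order ((CompP.conn (Γ := Γ.ext Γ.n) (fun p => (hB p).weaken _)
      (hj.weaken _) hl).imp (CompN.adj (Γ := Γ.ext Γ.n) hl ((hB p).weaken _)).not)
  exact
    { ok := h0.or ((hj.lt CompN.order).and ((hnew.imp hjoins).and (hnew.not.imp
        (CompP.forall_fin fun p => ((hy p).eq (CompN.const 0)).and ((hx p).eq (CompN.const 0))))))
      head := CompN.ite h0 (CompN.stateCode hB (CompN.const 0) fun _ => CompN.const 0)
        (CompN.stateCode hB (hj.add (CompN.const 1)) fun p => (hd p).add ((hy p).add (hx p)))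
      fst := CompN.ite h0 (CompN.const 0) (CompN.stateCode hB hj hd)
      snd := CompN.ite h0 (CompN.const 0) (CompN.ite hnew (CompN.stateCode (CompN.child hB hi hr)
        CompN.order (CompN.child hy hi hy₀)) (CompN.const 0))
      weight := h0.ite (Comp.const 0) (hnew.ite
        (hr.val (hy₀.add (CompN.sum_fin hx))) (Comp.const 0)) }

/-- Every sequence of digits occurs in every round. -/
theorem exists_digits {m : ℕ} (t : ℕ) : ∀ (L : ℕ) (g : ℕ → ℕ), (∀ q < L, g q < m) →
    ∃ c, t * m ^ L ≤ c ∧ c < (t + 1) * m ^ L ∧ ∀ q < L, c / m ^ q % m = g q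
  | 0, _, _ => ⟨t, by simp⟩
  | L + 1, g, hg => by
    obtain ⟨c, h1, h2, h3⟩ := exists_digits t L (fun q => g (q + 1)) fun q hq => hg _ (by omega)
    have h0 := hg 0 (by omega)
    refine ⟨g 0 + m * c, ?_, ?_, ?_⟩
    · rw [pow_succ]
      nlinarith
    · rw [pow_succ]
      nlinarith
    · rintro (_ | q) hq
      · rw [pow_zero, Nat.div_one, Nat.add_mul_mod_self_left, Nat.mod_eq_of_lt h0]
      · rw [pow_succ', ← Nat.div_div_eq_div_mul, Nat.add_mul_div_left _ _ (by omega),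
          Nat.div_eq_of_lt h0, zero_add, h3 q (by omega)]

/-- The sequence of digits that encodes given parameters. -/
def Param.digit (a : Param k) (q : ℕ) : ℕ :=
  if q = 0 then a.kind else if q = 1 then a.j else if q = 2 then a.i else if q = 3 then a.r
  else if q = 4 then a.y₀ else
    let p : Fin (k + 1) := Fin.ofNat (k + 1) ((q - 5) / 4)
    if (q - 5) % 4 = 0 then a.B p else if (q - 5) % 4 = 1 then a.d p
    else if (q - 5) % 4 = 2 then a.y p else a.x p

/-- All parameters are less than `m`. -/
structure Param.Below (a : Param k) (m : ℕ) : Prop where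
  kind : a.kind < m
  j : a.j < m
  i : a.i < m
  r : a.r < m
  y₀ : a.y₀ < m
  B : ∀ p, a.B p < m
  d : ∀ p, a.d p < m
  y : ∀ p, a.y p < m
  x : ∀ p, a.x p < m

theorem Param.Below.exists_decode {a : Param k} {m : ℕ} (ha : a.Below m) (t : ℕ) :
    ∃ c, t * m ^ (4 * k + 9) ≤ c ∧ c < (t + 1) * m ^ (4 * k + 9) ∧ Param.decode k m c = a := by
  obtain ⟨c, h1, h2, h3⟩ := exists_digits (m := m) t (4 * k + 9) a.digit (fun q _ => by
    unfold Param.digit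
    have := ha.kind
    have := ha.j
    have := ha.i
    have := ha.r
    have := ha.y₀
    have := ha.B (Fin.ofNat (k + 1) ((q - 5) / 4))
    have := ha.d (Fin.ofNat (k + 1) ((q - 5) / 4))
    have := ha.y (Fin.ofNat (k + 1) ((q - 5) / 4))
    have := ha.x (Fin.ofNat (k + 1) ((q - 5) / 4))
    dsimp only
    split_ifs <;> assumption)
  refine ⟨c, h1, h2, ?_⟩
  have key : ∀ (p : Fin (k + 1)) (s : ℕ), s < 4 →
      Fin.ofNat (k + 1) ((4 * (p : ℕ) + (5 + s) - 5) / 4) = p ∧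
        (4 * (p : ℕ) + (5 + s) - 5) % 4 = s := by
    intro p s hs
    have e : (4 * (p : ℕ) + (5 + s) - 5) / 4 = p := by omega
    exact ⟨by rw [e]; exact Fin.cast_val_eq_self p, by omega⟩
  have big : ∀ (p : Fin (k + 1)) (s : ℕ), s < 4 →
      c / m ^ (4 * (p : ℕ) + (5 + s)) % m = if s = 0 then a.B p else if s = 1 then a.d p
        else if s = 2 then a.y p else a.x p := by
    intro p s hs
    have := p.2
    rw [h3 _ (by omega), Param.digit, if_neg (by omega), if_neg (by omega), if_neg (by omega),
      if_neg (by omega), if_neg (by omega), (key p s hs).1, (key p s hs).2]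
  cases a
  simp only [Param.decode, Param.mk.injEq]
  exact ⟨h3 0 (by omega), h3 1 (by omega), h3 2 (by omega), h3 3 (by omega), h3 4 (by omega),
    funext fun p => big p 0 (by omega), funext fun p => big p 1 (by omega),
    funext fun p => big p 2 (by omega), funext fun p => big p 3 (by omega)⟩

/-! ### Correctness of the dynamic program -/

theorem Inst.isGraph (I : Inst) : IsGraph I.n I.Adj :=
  ⟨fun _ _ ⟨ha, hb, h⟩ => ⟨hb, ha, h.symm⟩, fun _ ⟨_, _, h⟩ => I.graph.loopless.irrefl _ h,
    fun _ _ ⟨ha, _, _⟩ => ha⟩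

/-- The base of the digits, large enough for vertices, degrees and positions in a bag. -/
def Inst.base (I : Inst) (k : ℕ) : ℕ := I.n + k + 2

/-- The table of the dynamic program. -/
noncomputable def Inst.table (I : Inst) (k : ℕ) : ℕ → ℕ → Option ℤ :=
  DegSeq.table 0 fun c => (Param.decode k (I.base k) c).rule I

theorem attained_of_table {I : Inst} {c : ℕ} {B d : Fin (k + 1) → ℕ} {j : ℕ} {v : ℤ}
    (h : I.table k c (stateCode B j d) = some v) : Attained I.n I.Adj I.val B j d v := by
  -- The soundness predicate for table entries; the initial entry has index `0` and value `0`.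
  let S : ℕ → ℤ → Prop := fun i v => (i = 0 ∧ v = 0) ∨
    ∃ (B : Fin (k + 1) → ℕ) (j : ℕ) (d : Fin (k + 1) → ℕ), i = stateCode B j d ∧
      Attained I.n I.Adj I.val B j d v
  have hS : ∀ (B : Fin (k + 1) → ℕ) j d v, S (stateCode B j d) v → Attained I.n I.Adj I.val B j d v := by
    rintro B j d v (⟨h, -⟩ | ⟨B', j', d', h, h'⟩)
    · exact absurd h (Nat.succ_ne_zero _)
    · obtain ⟨rfl, rfl, rfl⟩ := stateCode_inj h
      exact h'
  have hS0 : ∀ v, S 0 v → v = 0 := by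
    rintro v (⟨-, h⟩ | ⟨B', j', d', h, -⟩)
    · exact h
    · exact absurd h.symm (Nat.succ_ne_zero _)
  refine hS _ _ _ _ (table_sound (S := S) (.inl ⟨rfl, rfl⟩) ?_ _ _ _ h)
  intro c u w hok hu hw
  generalize Param.decode k (I.base k) c = a at *
  by_cases h0 : a.kind = 0
  · simp only [Param.rule, if_pos h0] at hu hw ⊢
    rw [hS0 _ hu, hS0 _ hw]
    exact .inr ⟨_, _, _, rfl, attained_zero⟩
  · obtain ⟨hj, hok1, hok2⟩ := hok.resolve_left h0
    simp only [Param.rule, if_neg h0] at hu hw ⊢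
    refine .inr ⟨_, _, _, rfl, ?_⟩
    by_cases hnew : New I.n I.Adj a.B a.j
    · simp only [if_pos hnew] at hw ⊢
      obtain ⟨hr, ⟨i, hi, hyi, hi'⟩, hx⟩ := hok1 hnew
      rw [← hi] at hw
      exact (hS _ _ _ _ hu).succ_of_new I.isGraph hj hnew hr hi' hx hyi (hS _ _ _ _ hw)
    · simp only [if_neg hnew] at hw ⊢
      rw [hS0 _ hw, add_zero, add_zero]
      simpa [hok2 hnew] using (hS _ _ _ _ hu).succ_of_not_new I.isGraph hnew

/-- After `t` rounds the table has an entry with value at most `c` for a state. -/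
def Derivable (I : Inst) (t : ℕ) (B : Fin (k + 1) → ℕ) (j : ℕ) (d : Fin (k + 1) → ℕ) (c : ℤ) :
    Prop :=
  AtMost (I.table k (t * I.base k ^ (4 * k + 9))) (stateCode B j d) c

theorem atMost_zero {I : Inst} {c : ℕ} : AtMost (I.table k c) 0 0 :=
  AtMost.table_mono (Nat.zero_le c) ⟨0, le_rfl, by simp [table]⟩

theorem AtMost.decode_rule {I : Inst} {t : ℕ} {a : Param k} (ha : a.Below (I.base k)) {u w : ℤ}
    (hok : (a.rule I).ok)
    (hu : AtMost (I.table k (t * I.base k ^ (4 * k + 9))) (a.rule I).fst u)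
    (hw : AtMost (I.table k (t * I.base k ^ (4 * k + 9))) (a.rule I).snd w) :
    AtMost (I.table k ((t + 1) * I.base k ^ (4 * k + 9))) (a.rule I).head
      (u + w + (a.rule I).weight) := by
  obtain ⟨c, h1, h2, rfl⟩ := ha.exists_decode t
  exact AtMost.table_rule (R := fun c => (Param.decode k (I.base k) c).rule I) h1 h2 hok hu hw

theorem region_root {n : ℕ} {h : ℕ → ℕ → Prop} :
    region n h (fun _ : Fin (k + 1) => n) n = Finset.range n := by
  ext u
  rw [mem_region, Finset.mem_range]
  exact ⟨fun hu => hu.1, fun hu => ⟨hu, fun _ => hu.ne', ⟨u, hu, .refl, .inl le_rfl⟩, u, hu, .refl⟩⟩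

/-- The index of the state that comprises the whole graph. -/
def rootCode (k n : ℕ) : ℕ := stateCode (fun _ : Fin (k + 1) => n) n fun _ => 0

theorem exists_of_table {I : Inst} {c : ℕ} {v : ℤ} (h : I.table k c (rootCode k I.n) = some v) :
    ∃ G, IsSub I.Adj G ∧ v = costIn I.n I.val G (Finset.range I.n) := by
  obtain ⟨G, hG, -, hv⟩ := attained_of_table h fun p q _ hlt => absurd hlt (lt_irrefl _)
  rw [region_root] at hv
  exact ⟨G, hG, hv⟩

theorem atMost_root {I : Inst} (hI : treewidth I.graph ≤ (k : ℕ∞)) {G : ℕ → ℕ → Prop}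
    (hG : IsSub I.Adj G) :
    AtMost (I.table k ((I.n + 1) ^ 2 * I.base k ^ (4 * k + 9))) (rootCode k I.n)
      (costIn I.n I.val G (Finset.range I.n)) := by
  obtain ⟨rank, hrank⟩ := exists_isElimination hI (h := I.Adj) fun _ _ => Iff.rfl
  have hbase : I.n + k + 2 = I.base k := rfl
  have key := derivable_of_isElimination (k := k) (F := I.val) I.isGraph hrank (Derivable I)
    ?_ ?_ ?_ ?_ hG I.n (fun _ => I.n) (fun _ => le_rfl) (fun _ _ _ hlt => absurd hlt (lt_irrefl _))
    (fun u _ v _ p hv => ?_) (by rw [region_root, Finset.card_range]) I.n le_rfl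
  · have hd : (fun p : Fin (k + 1) => degIn G (region I.n I.Adj (fun _ : Fin (k + 1) => I.n) I.n)
        ((fun _ => I.n) p)) = fun _ => 0 := by
      classical
      funext p
      rw [degIn, Finset.card_eq_zero, Finset.filter_eq_empty_iff]
      exact fun v _ hv => lt_irrefl _ (I.isGraph.lt _ _ (hG.le _ _ hv))
    rw [hd, region_root] at key
    have e : (I.n + 1) * I.n + I.n + 1 = (I.n + 1) ^ 2 := by ring
    rw [e] at key
    exact key
  · intro t t' B j d c ht h
    exact AtMost.table_mono (Nat.mul_le_mul_right _ ht) h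
  · intro t B hB
    have := AtMost.decode_rule (I := I) (t := t) (a := ⟨0, 0, 0, 0, 0, B, fun _ => 0, fun _ => 0,
      fun _ => 0⟩) (u := 0) (w := 0) (by
        constructor <;> intros <;> dsimp only <;> first | omega | (have := hB ‹_›; omega))
      (.inl rfl) (by simpa [Derivable, Param.rule] using atMost_zero) (by simpa [Derivable, Param.rule] using atMost_zero)
    simpa [Derivable, Param.rule] using this
  · intro t B j d c hB hd hj hnew h
    have := AtMost.decode_rule (I := I) (t := t) (a := ⟨1, j, 0, 0, 0, B, d, fun _ => 0,
      fun _ => 0⟩) (u := c) (w := 0) (by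
        constructor <;> intros <;> dsimp only <;>
          first | omega | (have := hB ‹_›; omega) | (have := hd ‹_›; omega))
      (.inr ⟨hj, fun h' => absurd h' hnew, fun _ _ => ⟨rfl, rfl⟩⟩)
      (by simpa [Derivable, Param.rule] using h) (by simpa [Derivable, Param.rule, hnew] using atMost_zero)
    simpa [Derivable, Param.rule, hnew] using this
  · intro t B j r y₀ i d x y c c' hB hd hy hy₀ hj hnew hr hi hx hyi h h'
    have hrn := hr.lt I.isGraph hj
    have hx' : ∀ p, x p ≤ 1 := fun p => by
      rcases hx p with h | h <;> omega
    have hin := i.2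
    have := AtMost.decode_rule (I := I) (t := t) (a := ⟨1, j, i, r, y₀, B, d, y, x⟩) (u := c) (w := c')
      (by
        constructor <;> intros <;> dsimp only <;>
          first | omega | (have := hB ‹_›; omega) | (have := hd ‹_›; omega) |
            (have := hy ‹_›; omega) | (have := hx' ‹_›; omega))
      (.inr ⟨hj, fun _ => ⟨hr, ⟨i, rfl, hyi, hi⟩, hx⟩, fun h => absurd hnew h⟩)
      (by simpa [Derivable, Param.rule] using h) (by simpa [Derivable, Param.rule, hnew] using h')
    simpa [Derivable, Param.rule, hnew] using this
  · exact absurd (I.isGraph.lt _ _ (I.isGraph.symm _ _ hv)) (lt_irrefl _)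

theorem costIn_eq_degreeCost (I : Inst) {G : SimpleGraph (Fin I.n)} {R : ℕ → ℕ → Prop}
    (hR : ∀ u v, R u v ↔ ∃ (hu : u < I.n) (hv : v < I.n), G.Adj ⟨u, hu⟩ ⟨v, hv⟩) :
    costIn I.n I.val R (Finset.range I.n) = degreeCost I.cost G := by
  classical
  rw [costIn, Finset.sum_range, degreeCost]
  refine Finset.sum_congr rfl fun u _ => ?_
  have hd : degIn R (Finset.range I.n) u = G.degree u := by
    have : (Finset.range I.n).filter (R u) = (G.neighborFinset u).map Fin.valEmbedding := by
      ext v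
      simp only [Finset.mem_filter, Finset.mem_range, hR, Finset.mem_map,
        SimpleGraph.mem_neighborFinset, Fin.valEmbedding_apply]
      constructor
      · rintro ⟨hv, _, _, h⟩
        exact ⟨⟨v, hv⟩, h, rfl⟩
      · rintro ⟨w, hw, rfl⟩
        exact ⟨w.2, u.2, w.2, hw⟩
    rw [degIn, this, Finset.card_map, SimpleGraph.card_neighborFinset_eq_degree]
  rw [hd, Inst.val]
  have hlt : G.degree u < I.n := by simpa using G.degree_lt_card_verts u
  rw [matrixArray_apply I.cost u ⟨G.degree u, hlt⟩]

theorem isLeast_table {I : Inst} (hI : treewidth I.graph ≤ (k : ℕ∞)) :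
    IsLeast {c : ℤ | ∃ G : SimpleGraph (Fin I.n), G ≤ I.graph ∧ degreeCost I.cost G = c}
      ((I.table k ((I.n + 1) ^ 2 * I.base k ^ (4 * k + 9)) (rootCode k I.n)).getD 0) := by
  have low : ∀ G : SimpleGraph (Fin I.n), G ≤ I.graph →
      AtMost (I.table k ((I.n + 1) ^ 2 * I.base k ^ (4 * k + 9))) (rootCode k I.n)
        (degreeCost I.cost G) := by
    intro G hG
    rw [← costIn_eq_degreeCost I (R := fun u v =>
      ∃ (hu : u < I.n) (hv : v < I.n), G.Adj ⟨u, hu⟩ ⟨v, hv⟩) fun _ _ => Iff.rfl]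
    exact atMost_root hI ⟨fun _ _ ⟨ha, hb, h⟩ => ⟨hb, ha, h.symm⟩,
      fun _ _ ⟨ha, hb, h⟩ => ⟨ha, hb, hG h⟩⟩
  obtain ⟨v, -, hv⟩ := low ⊥ bot_le
  rw [hv, Option.getD_some]
  constructor
  · obtain ⟨R, hR, hvR⟩ := exists_of_table hv
    let G : SimpleGraph (Fin I.n) :=
      { Adj := fun u v => R u v
        symm := ⟨fun u v h => hR.symm _ _ h⟩
        loopless := ⟨fun u h => I.isGraph.irrefl _ (hR.le _ _ h)⟩ }
    refine ⟨G, fun u v h => (hR.le _ _ h).2.2, ?_⟩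
    rw [hvR, costIn_eq_degreeCost I (G := G)]
    exact fun a b => ⟨fun h => ⟨(hR.le _ _ h).1, (hR.le _ _ h).2.1, h⟩, fun ⟨_, _, h⟩ => h⟩
  · rintro _ ⟨G, hG, rfl⟩
    obtain ⟨v', hv', h⟩ := low G hG
    rw [hv] at h
    cases h
    exact hv'

/-- The context without variables. -/
def Ctx.empty : Ctx where
  X := Inst
  inst I := I
  Valid _ := True
  ι := Empty
  var i _ := i.elim

theorem comp_table (k : ℕ) : Comp Ctx.empty fun I =>
    (I.table k ((I.n + 1) ^ 2 * I.base k ^ (4 * k + 9)) (rootCode k I.n)).getD 0 := by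
  have hn : CompN Ctx.empty fun I => I.n := CompN.order
  have hm : CompN Ctx.empty fun I => I.base k := (hn.add (CompN.const k)).add (CompN.const 2)
  have hN : CompN Ctx.empty fun I => (I.n + 1) ^ 2 * I.base k ^ (4 * k + 9) :=
    ((hn.add (CompN.const 1)).pow 2).mul (hm.pow _)
  exact (Comp.table (CompN.const 0) (CompN.stateCode (fun _ => hn) hn fun _ => CompN.const 0) hN
    (compRule_decode (hm.weaken _) (fun _ _ => Nat.succ_pos _) hN.last)).2

end DegSeq

open DegSeq in
theorem theorem1p1 (k : ℕ) :
    ∃ (P : Program) (p : Polynomial ℕ),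
      ∀ (n : ℕ) (H : SimpleGraph (Fin n)), treewidth H ≤ (k : ℕ∞) →
        ∀ f : Fin n → Fin n → ℤ,
          ∃ (t : ℕ) (s : Store), Exec P (inputStore H f) t s ∧ t ≤ p.eval n ∧
            IsLeast {c : ℤ | ∃ G : SimpleGraph (Fin n), G ≤ H ∧ degreeCost f G = c} (s 0 0) := by
  obtain ⟨P, q, hP⟩ := comp_table k (fun i => i.elim) 3 le_rfl fun i => i.elim
  refine ⟨.seq P (.setCell 0 (.cell 3)), q + 4, fun n H hH f => ?_⟩
  have h := hP ⟨n, H, f⟩ trivial (inputStore H f) ⟨fun _ _ => rfl, fun i => i.elim⟩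
  obtain ⟨t, s, he, ht, hs⟩ := h.seq (P' := .setCell 0 (.cell 3)) (T' := 4)
    (Q' := fun s => IsLeast {c : ℤ | ∃ G : SimpleGraph (Fin n), G ≤ H ∧ degreeCost f G = c} (s 0 0))
    fun s hs => Runs.setCell fun s' h1 _ => by
      rw [h1]
      simp only [RExpr.eval]
      rw [hs.2]
      exact isLeast_table (I := ⟨n, H, f⟩) hH
  exact ⟨t, s, he, by simpa using show t ≤ q.eval n + 4 from ht, hs⟩
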